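/- Let $\Gamma\subset SL_2(\mathbb Z)$ be a subgroup of finite index, $k\in\mathbb C$, and let $v:\Gamma\to\mathbb C\setminus\{0\}$ be a multiplier system compatible with weight $k$, i.e. the equation $f(\gamma z)=v(\gamma)e^{ik\arg(cz+d)}f(z)$ for all $\gamma=\begin{pmatrix}a&b\\c&d\end{pmatrix}\in\Gamma$ and $z\in\mathbb H$ has a non-zero solution $f$ (here $\arg\in(-\pi,\pi]$). Assume that $v$ is weakly parabolic: $|v(\gamma)|=1$ for all parabolic $\gamma\in\Gamma$. For $g\in SL_2(\mathbb Z)$ with lower row $(c,d)$ put $(f|_kg)(z)=e^{-ik\arg(cz+d)}f(gz)$. Let $\nu\in\mathbb C$ with $\nu\notin\{-\tfrac12,-1,-\tfrac32,\dots\}$, and let $u:\mathbb H\to\mathbb C$ be a generalized Maass wave form of weight $k$, multiplier $v$ and eigenvalue $\lambda=\tfrac14-\nu^2$ for $\Gamma$: $u$ is real-analytic, $u|_k\gamma=v(\gamma)u$ for all $\gamma\in\Gamma$, $\Delta_ku=\lambda u$ with $\Delta_k=-y^2(\partial_x^2+\partial_y^2)+iky\,\partial_x$, and at every cusp, with scaling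 matrix $g$, there is $c\in\mathbb R$ with $u(gz)=O(e^{cy})$ as $y\to\infty$, locally uniformly in $x$. Let $q=g_q\infty$ be a cusp with scaling matrix $g_q\in SL_2(\mathbb Z)$, let $l_q\ge1$ be the least integer with $\gamma_q:=g_qT^{l_q}g_q^{-1}\in\Gamma$, where $T=\begin{pmatrix}1&1\\0&1\end{pmatrix}$, and let $\kappa\in\mathbb R$ with $v(\gamma_q)=e^{2\pi i\kappa}$. If $\nu=0$, assume $v(\gamma_q)\ne1$. Let $c\in\mathbb R$ with $u(g_qz)=O(e^{cy})$ as above, and let $M>c$. Let $W_{\mu,\nu},M_{\mu,\nu}$ denote the Whittaker functions, and put $\widetilde W_{\mu,\nu}=W_{\mu,\nu}$ and $\widetilde M_{\mu,\nu}=\frac{\Gamma(\frac12+\nu-\mu)}{\Gamma(1+2\nu)}M_{\mu,\nu}$ (defined for $\mu-\nu\notin\{\tfrac12,\tfrac32,\tfrac52,\dots\}$). Assume that the functions $\widetilde M_{\operatorname{sign}(n)k/2,\nu}$ that occur in the second sum below are defined. Then there are complex numbers $A_n$, $B_n$, $C_+$, $C_-$ such that for all $z=x+iy\in\mathbb H$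 $$\begin{aligned}(u|_kg_q)(z)={}&\sum_{\substack{n\equiv\kappa\bmod 1\\ n\ne0}}A_n|n|^{-1/2}\,\widetilde W_{\operatorname{sign}(n)\frac k2,\nu}\Big(\frac{4\pi|n|}{l_q}y\Big)e^{2\pi inx/l_q}\\&+\sum_{\substack{n\equiv\kappa\bmod 1\\ n\neq0,\ 2\pi|n|/l_q<M}}B_n|n|^{-1/2}\,\widetilde M_{\operatorname{sign}(n)\frac k2,\nu}\Big(\frac{4\pi|n|}{l_q}y\Big)e^{2\pi inx/l_q}\\&+C_+y^{\frac12+\nu}+C_-y^{\frac12-\nu},\end{aligned}$$ where $n$ runs over real numbers, the first sum converges absolutely and the second one is finite. Moreover $C_+=C_-=0$ if $v(\gamma_q)\ne1$. -/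

import Mathlib

open UpperHalfPlane Filter Asymptotics
open scoped MatrixGroups Topology

noncomputable section

namespace GenMaass

/-! ### Slash action, multiplier systems -/

/-- The factor `c z + d` of `g = (a b; c d)`. -/
def cocycle (g : SL(2, ℤ)) (z : ℍ) : ℂ := ((g 1 0 : ℤ) : ℂ) * (z : ℂ) + ((g 1 1 : ℤ) : ℂ)

/-- The factor `e^{i k arg(c z + d)}`, with the principal argument in `(-π, π]`. -/
def argFactor (k : ℂ) (g : SL(2, ℤ)) (z : ℍ) : ℂ :=
  Complex.exp (Complex.I * k * (Complex.arg (cocycle g z) : ℂ))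

/-- The slash action `(f |_k g)(z) = e^{-i k arg(c z + d)} f(g z)`. -/
def slash (k : ℂ) (g : SL(2, ℤ)) (f : ℍ → ℂ) (z : ℍ) : ℂ :=
  Complex.exp (-(Complex.I * k * (Complex.arg (cocycle g z) : ℂ))) * f (g • z)

/-- `v : Γ → ℂ \ {0}` is a multiplier system compatible with the weight `k`: the equation
`f(γ z) = v(γ) e^{i k arg(c z + d)} f(z)` (for all `γ ∈ Γ`) allows non-zero solutions `f`. -/
def IsMultiplier (Γ : Subgroup SL(2, ℤ)) (k : ℂ) (v : Γ → ℂˣ) : Prop :=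
  ∃ f : ℍ → ℂ, f ≠ 0 ∧
    ∀ (γ : Γ) (z : ℍ), f ((γ : SL(2, ℤ)) • z) = (v γ : ℂ) * argFactor k (γ : SL(2, ℤ)) z * f z

/-- `|v(γ)| = 1` for all parabolic `γ ∈ Γ`. -/
def IsWeaklyParabolic (Γ : Subgroup SL(2, ℤ)) (v : Γ → ℂˣ) : Prop :=
  ∀ γ : Γ, ((γ : SL(2, ℤ)) : Matrix (Fin 2) (Fin 2) ℤ).IsParabolic → ‖(v γ : ℂ)‖ = 1

/-! ### The Laplace operator and generalized Maass wave forms -/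

/-- `∂u/∂x` for a function on the upper half-plane, `z = x + i y`. -/
def partialX (u : ℍ → ℂ) (z : ℍ) : ℂ :=
  fderiv ℝ (fun w : ℂ => u (ofComplex w)) (z : ℂ) 1

/-- `∂u/∂y` for a function on the upper half-plane, `z = x + i y`. -/
def partialY (u : ℍ → ℂ) (z : ℍ) : ℂ :=
  fderiv ℝ (fun w : ℂ => u (ofComplex w)) (z : ℂ) Complex.I

/-- `Δ_k = -y² (∂_x² + ∂_y²) + i k y ∂_x`. -/
def laplacian (k : ℂ) (u : ℍ → ℂ) (z : ℍ) : ℂ :=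
  -(z.im : ℂ) ^ 2 * (partialX (partialX u) z + partialY (partialY u) z)
    + Complex.I * k * (z.im : ℂ) * partialX u z

/-- `u(g z) = O(e^{c y})` as `y → ∞`, locally uniformly in `x`. -/
def HasExpGrowthAt (g : SL(2, ℤ)) (u : ℍ → ℂ) (c : ℝ) : Prop :=
  ∀ X : ℝ, (fun z : ℍ => u (g • z))
    =O[atImInfty ⊓ 𝓟 {z : ℍ | |z.re| ≤ X}] (fun z : ℍ => Real.exp (c * z.im))

/-- Generalized Maass wave forms of weight `k`, multiplier `v` and eigenvalue `ev` for `Γ`.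
The cusps of a finite index subgroup of `SL(2, ℤ)` are the points `g ∞`, and the matrices
`g ∈ SL(2, ℤ)` are their scaling matrices, so the growth condition is imposed for every `g`. -/
structure IsGeneralizedMaassForm (Γ : Subgroup SL(2, ℤ)) (k : ℂ) (v : Γ → ℂˣ) (ev : ℂ)
    (u : ℍ → ℂ) : Prop where
  analytic : AnalyticOnNhd ℝ (fun w : ℂ => u (ofComplex w)) {w : ℂ | 0 < w.im}
  slash_eq : ∀ (γ : Γ) (z : ℍ), slash k (γ : SL(2, ℤ)) u z = (v γ : ℂ) * u z
  eigen : ∀ z : ℍ, laplacian k u z = ev * u z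
  growth : ∀ g : SL(2, ℤ), ∃ c : ℝ, HasExpGrowthAt g u c

/-- `l` is the width at the cusp `g ∞` with scaling matrix `g`, and `γ` the corresponding parabolic
generator: `g⁻¹ γ g = T^l` with `γ ∈ Γ`, where `l ≥ 1` is as small as possible. -/
structure IsCuspGenerator (Γ : Subgroup SL(2, ℤ)) (g : SL(2, ℤ)) (l : ℕ) (γ : Γ) : Prop where
  pos : 0 < l
  conj_eq : g⁻¹ * (γ : SL(2, ℤ)) * g = ModularGroup.T ^ l
  minimal : ∀ m : ℕ, 0 < m → g * ModularGroup.T ^ m * g⁻¹ ∈ Γ → l ≤ m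

/-! ### Whittaker functions -/

/-- Kummer's function `₁F₁(a; b; t) = ∑ (a)_j / (b)_j t^j / j!`, for `b ∉ {0, -1, -2, …}`. -/
def kummer (a b : ℂ) (t : ℝ) : ℂ :=
  ∑' j : ℕ, (ascPochhammer ℂ j).eval a / (ascPochhammer ℂ j).eval b
    * ((t : ℂ) ^ j / (Nat.factorial j : ℂ))

/-- `M_{κ,ν}(t) = e^{-t/2} t^{1/2+ν} ₁F₁(1/2 + ν - κ; 1 + 2ν; t)`, for `t > 0`. -/
def whittakerM (κ ν : ℂ) (t : ℝ) : ℂ :=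
  Complex.exp (-(t : ℂ) / 2) * (t : ℂ) ^ (1 / 2 + ν) * kummer (1 / 2 + ν - κ) (1 + 2 * ν) t

/-- The integral representation of `W_{κ,ν}(t)`, valid for `Re (1/2 + ν - κ) > 0` and `t > 0`. -/
def whittakerWIntegral (κ ν : ℂ) (t : ℝ) : ℂ :=
  Complex.exp (-(t : ℂ) / 2) * (t : ℂ) ^ (1 / 2 + ν) / Complex.Gamma (1 / 2 + ν - κ)
    * ∫ s in Set.Ioi (0 : ℝ), Complex.exp (-((t : ℂ) * (s : ℂ)))
        * (s : ℂ) ^ (ν - κ - 1 / 2) * ((1 : ℂ) + (s : ℂ)) ^ (ν + κ - 1 / 2)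

/-- `W_{κ+j,ν}`, for `Re (1/2 + ν - κ) > 0`, by the relation
`W_{κ+1,ν}(t) = (t/2 - κ) W_{κ,ν}(t) - t W_{κ,ν}'(t)`. -/
def whittakerWRaise (κ ν : ℂ) : ℕ → ℝ → ℂ
  | 0 => whittakerWIntegral κ ν
  | j + 1 => fun t => ((t : ℂ) / 2 - (κ + (j : ℂ))) * whittakerWRaise κ ν j t
      - (t : ℂ) * deriv (whittakerWRaise κ ν j) t

/-- The least natural number `j` with `Re (1/2 + ν - (κ - j)) > 0`. -/
def whittakerShift (κ ν : ℂ) : ℕ := (⌊κ.re - ν.re - 1 / 2⌋ + 1).toNat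

/-- The Whittaker function `W_{κ,ν}(t)`, for all `κ, ν ∈ ℂ` and `t > 0`: the integral representation
where `Re (1/2 + ν - κ) > 0`, continued to all `κ` by the raising relation. -/
def whittakerW (κ ν : ℂ) (t : ℝ) : ℂ :=
  whittakerWRaise (κ - (whittakerShift κ ν : ℂ)) ν (whittakerShift κ ν) t

/-- `W̃_{κ,ν} = W_{κ,ν}`. -/
def whittakerWt (κ ν : ℂ) (t : ℝ) : ℂ := whittakerW κ ν t

/-- `M̃_{κ,ν} = Γ(1/2 + ν - κ) / Γ(1 + 2ν) · M_{κ,ν}`. -/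
def whittakerMt (κ ν : ℂ) (t : ℝ) : ℂ :=
  Complex.Gamma (1 / 2 + ν - κ) / Complex.Gamma (1 + 2 * ν) * whittakerM κ ν t

/-! ### The Whittaker-Fourier expansion -/

/-- The real numbers `n ≡ κ mod 1` with `n ≠ 0`. -/
def frequencies (κ : ℝ) : Set ℝ := {n : ℝ | (∃ m : ℤ, n = κ + (m : ℝ)) ∧ n ≠ 0}

/-- The real numbers `n ≡ κ mod 1` with `n ≠ 0` and `2π|n|/l < M`. -/
def lowFrequencies (κ : ℝ) (l : ℕ) (M : ℝ) : Set ℝ :=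
  {n : ℝ | n ∈ frequencies κ ∧ 2 * Real.pi * |n| / (l : ℝ) < M}

theorem lowFrequencies_finite (κ : ℝ) (l : ℕ) (hl : 0 < l) (M : ℝ) :
    (lowFrequencies κ l M).Finite := by
  have hl' : (0 : ℝ) < l := by exact_mod_cast hl
  set R : ℝ := M * l / (2 * Real.pi) with hR
  refine ((Set.finite_Icc ⌊-R - κ⌋ ⌈R - κ⌉).image (fun m : ℤ => κ + (m : ℝ))).subset ?_
  rintro n ⟨⟨⟨m, rfl⟩, -⟩, h⟩
  have h2 : |κ + (m : ℝ)| < R := by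
    rw [hR, lt_div_iff₀ (by positivity)]
    rw [div_lt_iff₀ hl'] at h
    linarith
  obtain ⟨h3, h4⟩ := abs_lt.mp h2
  refine ⟨m, ⟨?_, ?_⟩, rfl⟩
  · have : ((⌊-R - κ⌋ : ℤ) : ℝ) ≤ m := (Int.floor_le _).trans (by linarith)
    exact_mod_cast this
  · have : (m : ℝ) ≤ ((⌈R - κ⌉ : ℤ) : ℝ) := le_trans (by linarith) (Int.le_ceil _)
    exact_mod_cast this

/-- `|n|^{-1/2} W̃_{sign(n) k/2, ν}(4π|n|y/l) e^{2πinx/l}` with `z = x + i y`. -/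
def wTerm (k ν : ℂ) (l : ℕ) (n : ℝ) (z : ℍ) : ℂ :=
  ((|n| ^ (-(1 / 2) : ℝ) : ℝ) : ℂ)
    * whittakerWt ((Real.sign n : ℂ) * k / 2) ν (4 * Real.pi * |n| / (l : ℝ) * z.im)
    * Complex.exp (2 * Real.pi * Complex.I * n / (l : ℂ) * z.re)

/-- `|n|^{-1/2} M̃_{sign(n) k/2, ν}(4π|n|y/l) e^{2πinx/l}` with `z = x + i y`. -/
def mTerm (k ν : ℂ) (l : ℕ) (n : ℝ) (z : ℍ) : ℂ :=
  ((|n| ^ (-(1 / 2) : ℝ) : ℝ) : ℂ)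
    * whittakerMt ((Real.sign n : ℂ) * k / 2) ν (4 * Real.pi * |n| / (l : ℝ) * z.im)
    * Complex.exp (2 * Real.pi * Complex.I * n / (l : ℂ) * z.re)

end GenMaass

end

noncomputable section

namespace GenMaass

/-! The function `u|_k g` is again an eigenfunction of `Δ_k` (`slashC_isEigen`), and translation by
the cusp width `l` multiplies it by `e^{2πiκ}` (`slashC_add`). The second fact needs the arguments
of the automorphy factors to add exactly, without a jump by `2π` (`arg_jFactor_add`). Hence it has a
Fourier expansion in `x` with frequencies `α = 2πn/l`, `n ∈ κ + ℤ`. Two integrations by parts bound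
the coefficients by a multiple of `α⁻²` for each fixed `y`, so the series converges absolutely
(`hasSum_fourierInt`).

Separation of variables gives each coefficient the equation `a'' = (α² - kα/y - λ/y²) a`
(`isSol_fourierInt`). For `n ≠ 0` this is Whittaker's equation in `t = 4π|n|y/l`, with first
parameter `sign(n) k/2`. The coefficient inherits the bound `O(e^{cy})`. If `2π|n|/l ≥ M > c`, its
Wronskian with `W` is constant and tends to zero, so only `W` occurs (`eq_whittakerWt_of_isBigO`).
For the finitely many remaining `n ≠ 0` the coefficient is a combination of the fundamental system
`W`, `M̃` (`eq_whittakerWt_add_whittakerMt`). For `n = 0`, which occurs only if `κ ∈ ℤ`, that is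
`v(γ_q) = 1`, the equation is Euler's, with solutions `y^{1/2±ν}` (`eq_cpow_add_cpow`).

Two analytic facts about Whittaker functions carry this. First, `W` is a non-zero solution of size
`O(e^{-rt})` for every `r < 1/2` (`isRecessive_whittakerW`): this is read off the Laplace integral
and is preserved by raising `κ`. Second, `₁F₁(a; b; t)` is not subexponential unless `a ∈ {0, -1,
-2, …}` (`not_subexp_kummer`), so `M̃` is not a multiple of `W`. No asymptotic expansion of `M` and
no explicit Wronskian of `W` and `M̃` is needed. -/

/-! ### Linear second order equations `f'' = Q f` on `(0, ∞)` -/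

/-- `f` solves `f'' = Q f` on `(0, ∞)`, with first derivative `f'`. -/
def IsSol (Q f f' : ℝ → ℂ) : Prop :=
  ∀ t : ℝ, 0 < t → HasDerivAt f (f' t) t ∧ HasDerivAt f' (Q t * f t) t

namespace IsSol

variable {Q f f' g g' h h' : ℝ → ℂ}

theorem congr {F F' : ℝ → ℂ} (hf : IsSol Q f f') (h1 : ∀ t, 0 < t → F t = f t)
    (h2 : ∀ t, 0 < t → F' t = f' t) : IsSol Q F F' := by
  intro t ht
  have e1 : F =ᶠ[𝓝 t] f := by
    filter_upwards [Ioi_mem_nhds ht] with s hs using h1 s hs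
  have e2 : F' =ᶠ[𝓝 t] f' := by
    filter_upwards [Ioi_mem_nhds ht] with s hs using h2 s hs
  rw [h1 t ht, h2 t ht]
  exact ⟨(hf t ht).1.congr_of_eventuallyEq e1, (hf t ht).2.congr_of_eventuallyEq e2⟩

theorem congr_coeff {R : ℝ → ℂ} (hf : IsSol Q f f') (hR : ∀ t, 0 < t → R t = Q t) :
    IsSol R f f' := by
  intro t ht
  rw [hR t ht]
  exact hf t ht

theorem sub_combination (hf : IsSol Q f f') (hg : IsSol Q g g') (hh : IsSol Q h h') (A B : ℂ) :
    IsSol Q (fun t => f t - (A * g t + B * h t)) (fun t => f' t - (A * g' t + B * h' t)) := by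
  intro t ht
  refine ⟨(hf t ht).1.sub (((hg t ht).1.const_mul A).add ((hh t ht).1.const_mul B)), ?_⟩
  refine ((hf t ht).2.sub (((hg t ht).2.const_mul A).add ((hh t ht).2.const_mul B))).congr_deriv ?_
  ring

theorem zero : IsSol Q (fun _ => 0) (fun _ => 0) := by
  intro t _
  simp only [mul_zero]
  exact ⟨hasDerivAt_const _ _, hasDerivAt_const _ _⟩

theorem comp_mul (hf : IsSol Q f f') {β : ℝ} (hβ : 0 < β) :
    IsSol (fun t => (β : ℂ) ^ 2 * Q (β * t)) (fun t => f (β * t)) (fun t => β * f' (β * t)) := by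
  intro t ht
  have hb : HasDerivAt (fun s : ℝ => β * s) β t := by
    simpa using (hasDerivAt_id t).const_mul β
  have h1 := (hf (β * t) (mul_pos hβ ht)).1.scomp t hb
  have h2 := ((hf (β * t) (mul_pos hβ ht)).2.scomp t hb).const_mul (β : ℂ)
  refine ⟨h1.congr_deriv (by simp), h2.congr_deriv ?_⟩
  simp only [Complex.real_smul]
  ring

/-- A solution with vanishing Cauchy data vanishes. -/
theorem eq_zero (hf : IsSol Q f f') (hQ : ContinuousOn Q (Set.Ioi 0)) {t₀ : ℝ} (ht₀ : 0 < t₀)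
    (h0 : f t₀ = 0) (h0' : f' t₀ = 0) {t : ℝ} (ht : 0 < t) : f t = 0 := by
  -- A compact interval inside `(0, ∞)` with both points in its interior; `Q` is bounded there.
  set a : ℝ := min t₀ t / 2
  set b : ℝ := max t₀ t + 1
  have hm : 0 < min t₀ t := lt_min ht₀ ht
  have ha : 0 < a := by positivity
  have hat : a < t := (half_lt_self hm).trans_le (min_le_right _ _)
  have hat₀ : a < t₀ := (half_lt_self hm).trans_le (min_le_left _ _)
  have htb : t < b := (le_max_right t₀ t).trans_lt (lt_add_one _)
  have htb₀ : t₀ < b := (le_max_left t₀ t).trans_lt (lt_add_one _)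
  have hpos : ∀ s ∈ Set.Icc a b, 0 < s := fun s hs => ha.trans_le hs.1
  obtain ⟨C, hC⟩ := isCompact_Icc.exists_bound_of_continuousOn
    (hQ.mono (fun s hs => hpos s hs) : ContinuousOn Q (Set.Icc a b))
  -- Lipschitz constant, in the sup norm, of the first order system `(p₁, p₂)' = (p₂, Q p₁)`: the
  -- first component contributes `1`, the second the bound for `Q`.
  let K : NNReal := max 1 C.toNNReal
  let v : ℝ → ℂ × ℂ → ℂ × ℂ := fun s p => (p.2, Q s * p.1)
  have hv : ∀ s ∈ Set.Ioo a b, LipschitzOnWith K (v s) Set.univ := by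
    intro s hs
    refine LipschitzWith.lipschitzOnWith (LipschitzWith.of_dist_le_mul fun p q => ?_)
    rw [Prod.dist_eq, Prod.dist_eq]
    simp only [v, dist_eq_norm (E := ℂ), ← mul_sub, norm_mul]
    have hK1 : (1 : ℝ) ≤ K := by exact_mod_cast le_max_left (1 : NNReal) C.toNNReal
    have hKC : C ≤ K := (Real.le_coe_toNNReal C).trans
      (by exact_mod_cast le_max_right (1 : NNReal) C.toNNReal)
    have hQs : ‖Q s‖ ≤ K := (hC s (Set.Ioo_subset_Icc_self hs)).trans hKC
    have hK0 : (0 : ℝ) ≤ K := by positivity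
    refine max_le ?_ ?_
    · calc ‖p.2 - q.2‖ ≤ max ‖p.1 - q.1‖ ‖p.2 - q.2‖ := le_max_right _ _
        _ ≤ K * max ‖p.1 - q.1‖ ‖p.2 - q.2‖ := le_mul_of_one_le_left (by positivity) hK1
    · exact mul_le_mul hQs (le_max_left _ _) (norm_nonneg _) hK0
  have key := ODE_solution_unique_of_mem_Ioo (f := fun s => (f s, f' s)) (g := fun _ => (0, 0))
    (t₀ := t₀) hv ⟨hat₀, htb₀⟩
    (fun s hs => ⟨(hf s (hpos s (Set.Ioo_subset_Icc_self hs))).1.prodMk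
      (hf s (hpos s (Set.Ioo_subset_Icc_self hs))).2, Set.mem_univ _⟩)
    (fun s _ => ⟨(hasDerivAt_const s ((0 : ℂ), (0 : ℂ))).congr_deriv (by simp [v]; rfl),
      Set.mem_univ _⟩)
    (by simp [h0, h0'])
  exact congrArg Prod.fst (key ⟨hat, htb⟩)

/-- The equation has no first order term, so the derivative of the Wronskian is `f Q g - Q f g = 0`.
-/
theorem wronskian_const (hf : IsSol Q f f') (hg : IsSol Q g g') {s t : ℝ} (hs : 0 < s)
    (ht : 0 < t) : f s * g' s - f' s * g s = f t * g' t - f' t * g t := by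
  have hd : ∀ r : ℝ, 0 < r → HasDerivAt (fun r => f r * g' r - f' r * g r) 0 r := by
    intro r hr
    refine (((hf r hr).1.mul (hg r hr).2).sub ((hf r hr).2.mul (hg r hr).1)).congr_deriv ?_
    ring
  exact isOpen_Ioi.is_const_of_deriv_eq_zero (convex_Ioi (0 : ℝ)).isPreconnected
    (fun r hr => (hd r hr).differentiableAt.differentiableWithinAt)
    (fun r hr => (hd r hr).deriv) hs ht

/-- Cramer's rule matches the Cauchy data at `t₀`, and uniqueness does the rest. -/
theorem exists_combination (hf : IsSol Q f f') (hg : IsSol Q g g') (hh : IsSol Q h h')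
    (hQ : ContinuousOn Q (Set.Ioi 0)) {t₀ : ℝ} (ht₀ : 0 < t₀)
    (hW : g t₀ * h' t₀ - g' t₀ * h t₀ ≠ 0) :
    ∃ A B : ℂ, ∀ t : ℝ, 0 < t → f t = A * g t + B * h t := by
  set w := g t₀ * h' t₀ - g' t₀ * h t₀ with hw
  refine ⟨(f t₀ * h' t₀ - f' t₀ * h t₀) / w, (g t₀ * f' t₀ - g' t₀ * f t₀) / w, fun t ht => ?_⟩
  refine sub_eq_zero.mp ((hf.sub_combination hg hh _ _).eq_zero hQ ht₀ ?_ ?_ ht)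
  · field_simp
    rw [hw]
    ring
  · field_simp
    rw [hw]
    ring

/-- The vanishing Wronskian is moved to a point where `g ≠ 0`. There `f - (f/g)(t₁) g` has value
zero, and its derivative is zero because the Wronskian is. -/
theorem exists_smul (hf : IsSol Q f f') (hg : IsSol Q g g') (hQ : ContinuousOn Q (Set.Ioi 0))
    {t₀ t₁ : ℝ} (ht₀ : 0 < t₀) (hW : f t₀ * g' t₀ - f' t₀ * g t₀ = 0) (ht₁ : 0 < t₁)
    (hg0 : g t₁ ≠ 0) : ∃ A : ℂ, ∀ t : ℝ, 0 < t → f t = A * g t := by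
  rw [hf.wronskian_const hg ht₀ ht₁] at hW
  refine ⟨f t₁ / g t₁, fun t ht => ?_⟩
  have := (hf.sub_combination hg zero (f t₁ / g t₁) 0).eq_zero hQ ht₁ (by field_simp; ring)
    (by field_simp; linear_combination -hW) ht
  linear_combination this

/-- If `Q` is bounded near infinity, then exponential bounds carry over to the derivative. -/
theorem deriv_isBigO (hf : IsSol Q f f') (hQ : Q =O[atTop] fun _ => (1 : ℝ)) {c : ℝ}
    (hO : f =O[atTop] fun t => Real.exp (c * t)) : f' =O[atTop] fun t => Real.exp (c * t) := by
  obtain ⟨K, hK0, hK⟩ := hQ.exists_pos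
  obtain ⟨C, hC0, hC⟩ := hO.exists_pos
  obtain ⟨T, hT⟩ := eventually_atTop.mp (hK.bound.and hC.bound)
  refine IsBigO.of_bound (K * (C * Real.exp |c|) + C * Real.exp |c| + C) ?_
  filter_upwards [eventually_ge_atTop T, eventually_gt_atTop 0] with t htT ht
  have hexp : ∀ s ∈ Set.Icc t (t + 1), ‖f s‖ ≤ C * Real.exp |c| * Real.exp (c * t) := by
    intro s hs
    refine (hT s (htT.trans hs.1)).2.trans ?_
    rw [Real.norm_of_nonneg (Real.exp_pos _).le, mul_assoc, ← Real.exp_add]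
    gcongr
    have : c * (s - t) ≤ |c| * 1 := by
      refine (le_abs_self _).trans ?_
      rw [abs_mul]
      gcongr
      rw [abs_le]
      constructor <;> linarith [hs.1, hs.2]
    linarith
  set E := C * Real.exp |c| * Real.exp (c * t) with hE
  have hE0 : 0 ≤ E := by positivity
  have hf'' : ∀ s ∈ Set.Icc t (t + 1), ‖Q s * f s‖ ≤ K * E := by
    intro s hs
    rw [norm_mul]
    have h1 := (hT s (htT.trans hs.1)).1
    rw [norm_one, mul_one] at h1
    exact mul_le_mul h1 (hexp s hs) (norm_nonneg _) hK0.le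
  have hdiff : ∀ s ∈ Set.Icc t (t + 1), ‖f' s - f' t‖ ≤ K * E := by
    intro s hs
    refine (norm_image_sub_le_of_norm_deriv_le_segment'
      (fun r hr => (hf r (ht.trans_le hr.1)).2.hasDerivWithinAt)
      (fun r hr => hf'' r (Set.Ico_subset_Icc_self hr)) s hs).trans ?_
    have : s - t ≤ 1 := by linarith [hs.2]
    exact mul_le_of_le_one_right (by positivity) this
  have hone : t + 1 ∈ Set.Icc t (t + 1) := ⟨by linarith, le_rfl⟩
  -- First order Taylor formula on a unit interval: `s ↦ f s - s f'(t)` has derivative `f' s - f'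
  -- t`, which is small because `f'' = Q f` is. This expresses `f' t` by values of `f`.
  have htaylor : ‖(f (t + 1) - ((t + 1 : ℝ) : ℂ) * f' t) - (f t - (t : ℂ) * f' t)‖ ≤ K * E := by
    have := norm_image_sub_le_of_norm_deriv_le_segment' (a := t) (b := t + 1)
      (f := fun s => f s - (s : ℂ) * f' t) (f' := fun s => f' s - f' t) (C := K * E)
      (fun r hr => by
        refine ((hf r (ht.trans_le hr.1)).1.sub
          ((Complex.ofRealCLM.hasDerivAt (x := r)).mul_const (f' t))).hasDerivWithinAt.congr_deriv ?_
        simp)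
      (fun r hr => hdiff r (Set.Ico_subset_Icc_self hr)) (t + 1) hone
    simpa using this
  have hid : f' t = f (t + 1) - f t
      - ((f (t + 1) - ((t + 1 : ℝ) : ℂ) * f' t) - (f t - (t : ℂ) * f' t)) := by
    push_cast
    ring
  rw [hid]
  have h1 := hexp (t + 1) hone
  have h2 := (hT t htT).2
  rw [Real.norm_of_nonneg (Real.exp_pos _).le] at h2 ⊢
  calc _ ≤ ‖f (t + 1)‖ + ‖f t‖ + K * E :=
        (norm_sub_le _ _).trans (add_le_add (norm_sub_le _ _) htaylor)
    _ ≤ E + C * Real.exp (c * t) + K * E := by gcongr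
    _ = _ := by rw [hE]; ring

/-- A solution which decays faster than another one grows spans a line containing the latter. -/
theorem exists_smul_of_isBigO (hf : IsSol Q f f') (hg : IsSol Q g g')
    (hQc : ContinuousOn Q (Set.Ioi 0)) (hQ : Q =O[atTop] fun _ => (1 : ℝ)) {c d : ℝ} (hcd : c < d)
    (hfO : f =O[atTop] fun t => Real.exp (c * t)) (hgO : g =O[atTop] fun t => Real.exp (-d * t))
    {t₁ : ℝ} (ht₁ : 0 < t₁) (hg0 : g t₁ ≠ 0) : ∃ A : ℂ, ∀ t : ℝ, 0 < t → f t = A * g t := by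
  refine hf.exists_smul hg hQc ht₁ ?_ ht₁ hg0
  -- The Wronskian is constant and `O(e^{(c-d)t})` with `c < d`, so it vanishes.
  have hO : (fun t => f t * g' t - f' t * g t) =O[atTop]
      fun t => Real.exp (c * t) * Real.exp (-d * t) :=
    (hfO.mul (hg.deriv_isBigO hQ hgO)).sub ((hf.deriv_isBigO hQ hfO).mul hgO)
  have hlim : Tendsto (fun t : ℝ => Real.exp (c * t) * Real.exp (-d * t)) atTop (𝓝 0) := by
    simp_rw [← Real.exp_add, ← add_mul]
    refine Real.tendsto_exp_atBot.comp ?_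
    exact tendsto_id.const_mul_atTop_of_neg (by linarith)
  have h0 := hO.trans_tendsto hlim
  refine tendsto_nhds_unique (tendsto_const_nhds.congr' ?_) h0
  filter_upwards [eventually_gt_atTop 0] with t ht
  exact hf.wronskian_const hg ht₁ ht

end IsSol

open MeasureTheory

/-! ### Laplace integrals -/

theorem one_add_rpow_le (x : ℝ) : ∃ n : ℕ, ∀ s : ℝ, 0 ≤ s → (1 + s) ^ x ≤ 2 ^ n * (1 + s ^ n) := by
  refine ⟨⌈x⌉₊, fun s hs => ?_⟩
  calc (1 + s) ^ x ≤ (1 + s) ^ ((⌈x⌉₊ : ℕ) : ℝ) :=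
        Real.rpow_le_rpow_of_exponent_le (by linarith) (Nat.le_ceil x)
    _ = (1 + s) ^ ⌈x⌉₊ := Real.rpow_natCast _ _
    _ ≤ 2 ^ (⌈x⌉₊ - 1) * (1 ^ ⌈x⌉₊ + s ^ ⌈x⌉₊) := add_pow_le zero_le_one hs _
    _ ≤ 2 ^ ⌈x⌉₊ * (1 + s ^ ⌈x⌉₊) := by
        rw [one_pow]
        gcongr
        · exact one_le_two
        · exact Nat.sub_le _ _

theorem integrableOn_exp_rpow {t a : ℝ} (ht : 0 < t) (ha : -1 < a) :
    IntegrableOn (fun s : ℝ => Real.exp (-(t * s)) * s ^ a) (Set.Ioi 0) := by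
  refine (integrableOn_rpow_mul_exp_neg_mul_rpow ha one_pos ht).congr_fun (fun s _ => ?_)
    measurableSet_Ioi
  simp only [Real.rpow_one]
  rw [mul_comm, neg_mul]

theorem integrableOn_exp_rpow_one_add_rpow {t a : ℝ} (ht : 0 < t) (ha : -1 < a) (x : ℝ) :
    IntegrableOn (fun s : ℝ => Real.exp (-(t * s)) * s ^ a * (1 + s) ^ x) (Set.Ioi 0) := by
  obtain ⟨n, hn⟩ := one_add_rpow_le x
  have hdom : IntegrableOn (fun s : ℝ => 2 ^ n * (Real.exp (-(t * s)) * s ^ a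
      + Real.exp (-(t * s)) * s ^ (a + n))) (Set.Ioi 0) := by
    have hn' : -1 < a + n := by
      have : (0 : ℝ) ≤ n := n.cast_nonneg
      linarith
    exact ((integrableOn_exp_rpow ht ha).add (integrableOn_exp_rpow ht hn')).const_mul _
  refine Integrable.mono' hdom ?_ ?_
  · refine ContinuousOn.aestronglyMeasurable (fun s hs => ?_) measurableSet_Ioi
    have hs' : (0 : ℝ) < s := hs
    refine ContinuousAt.continuousWithinAt ?_
    refine (ContinuousAt.mul (by fun_prop) (Real.continuousAt_rpow_const _ _ (Or.inl hs'.ne'))).mul ?_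
    exact ContinuousAt.rpow_const (by fun_prop) (Or.inl (by positivity))
  · refine (ae_restrict_iff' measurableSet_Ioi).mpr (ae_of_all _ fun s hs => ?_)
    have hs' : (0 : ℝ) < s := hs
    rw [Real.norm_of_nonneg (by positivity), Real.rpow_add_natCast hs'.ne']
    calc Real.exp (-(t * s)) * s ^ a * (1 + s) ^ x
        ≤ Real.exp (-(t * s)) * s ^ a * (2 ^ n * (1 + s ^ n)) := by
          gcongr
          exact hn s hs'.le
      _ = _ := by ring

/-- The integrand `e^{-ts} s^α (1 + s)^β`. -/
def laplaceIntegrand (α β : ℂ) (t s : ℝ) : ℂ :=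
  Complex.exp (-((t : ℂ) * (s : ℂ))) * (s : ℂ) ^ α * ((1 : ℂ) + (s : ℂ)) ^ β

/-- The integral `∫₀^∞ e^{-ts} s^α (1 + s)^β ds`. -/
def laplaceIntegral (α β : ℂ) (t : ℝ) : ℂ :=
  ∫ s in Set.Ioi (0 : ℝ), laplaceIntegrand α β t s

theorem norm_laplaceIntegrand (α β : ℂ) (t : ℝ) {s : ℝ} (hs : 0 < s) :
    ‖laplaceIntegrand α β t s‖ = Real.exp (-(t * s)) * s ^ α.re * (1 + s) ^ β.re := by
  have h1 : ((1 : ℂ) + (s : ℂ)) = ((1 + s : ℝ) : ℂ) := by push_cast; rfl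
  rw [laplaceIntegrand, norm_mul, norm_mul, Complex.norm_cpow_eq_rpow_re_of_pos hs, h1,
    Complex.norm_cpow_eq_rpow_re_of_pos (by positivity), Complex.norm_exp]
  simp

theorem continuousOn_laplaceIntegrand (α β : ℂ) (t : ℝ) :
    ContinuousOn (laplaceIntegrand α β t) (Set.Ioi 0) := by
  intro s hs
  have hs' : (0 : ℝ) < s := hs
  refine ContinuousAt.continuousWithinAt ?_
  refine (ContinuousAt.mul (by fun_prop)
    (Complex.continuousAt_ofReal_cpow_const _ _ (Or.inr hs'.ne'))).mul ?_
  refine ContinuousAt.cpow (by fun_prop) continuousAt_const ?_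
  left
  simp only [Complex.add_re, Complex.one_re, Complex.ofReal_re]
  positivity

theorem integrableOn_laplaceIntegrand {α : ℂ} (hα : -1 < α.re) (β : ℂ) {t : ℝ} (ht : 0 < t) :
    IntegrableOn (laplaceIntegrand α β t) (Set.Ioi 0) := by
  refine Integrable.mono' (integrableOn_exp_rpow_one_add_rpow ht hα β.re)
    ((continuousOn_laplaceIntegrand α β t).aestronglyMeasurable measurableSet_Ioi) ?_
  refine (ae_restrict_iff' measurableSet_Ioi).mpr (ae_of_all _ fun s hs => ?_)
  exact (norm_laplaceIntegrand α β t hs).le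

theorem laplaceIntegrand_add_one (α β : ℂ) (t : ℝ) {s : ℝ} (hs : 0 < s) :
    laplaceIntegrand (α + 1) β t s = s * laplaceIntegrand α β t s := by
  have h0 : (s : ℂ) ≠ 0 := by exact_mod_cast hs.ne'
  rw [laplaceIntegrand, laplaceIntegrand, Complex.cpow_add _ _ h0, Complex.cpow_one]
  ring

/-- Differentiation in `t` brings down a factor `-s`, which raises `α` by one. -/
theorem hasDerivAt_laplaceIntegral {α : ℂ} (hα : -1 < α.re) (β : ℂ) {t : ℝ} (ht : 0 < t) :
    HasDerivAt (laplaceIntegral α β) (-laplaceIntegral (α + 1) β t) t := by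
  have hα1 : -1 < (α + 1).re := by
    simp only [Complex.add_re, Complex.one_re]
    linarith
  -- The modulus of the integrand decreases in `t`, so its value at `t / 2` dominates all parameters
  -- beyond `t / 2`.
  have key := hasDerivAt_integral_of_dominated_loc_of_deriv_le (μ := volume.restrict (Set.Ioi 0))
    (F := fun t s => laplaceIntegrand α β t s)
    (F' := fun t s => -laplaceIntegrand (α + 1) β t s) (x₀ := t) (s := Set.Ioi (t / 2))
    (bound := fun s => ‖laplaceIntegrand (α + 1) β (t / 2) s‖)
    (Ioi_mem_nhds (by linarith))
    (Eventually.of_forall fun r =>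
      (continuousOn_laplaceIntegrand α β r).aestronglyMeasurable measurableSet_Ioi)
    (integrableOn_laplaceIntegrand hα β ht)
    ((continuousOn_laplaceIntegrand (α + 1) β t).neg.aestronglyMeasurable measurableSet_Ioi)
    ((ae_restrict_iff' measurableSet_Ioi).mpr (ae_of_all _ fun s hs r hr => ?_))
    (integrableOn_laplaceIntegrand hα1 β (by positivity)).norm
    ((ae_restrict_iff' measurableSet_Ioi).mpr (ae_of_all _ fun s hs r hr => ?_))
  · refine key.2.congr_deriv ?_
    rw [integral_neg]
    rfl
  · have hs' : (0 : ℝ) < s := hs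
    rw [norm_neg, norm_laplaceIntegrand _ _ _ hs', norm_laplaceIntegrand _ _ _ hs']
    have : t / 2 ≤ r := le_of_lt hr
    gcongr
  · have hs' : (0 : ℝ) < s := hs
    rw [laplaceIntegrand_add_one _ _ _ hs']
    have h1 : HasDerivAt (fun r : ℝ => -((r : ℂ) * (s : ℂ))) (-(1 * (s : ℂ))) r :=
      ((Complex.ofRealCLM.hasDerivAt (x := r)).mul_const (s : ℂ)).neg
    refine ((h1.cexp.mul_const _).mul_const _).congr_deriv ?_
    rw [laplaceIntegrand]
    ring

/-- Kummer's differential equation for Laplace integrals. -/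
theorem laplaceIntegral_kummer {a : ℂ} (ha : 0 < a.re) (b : ℂ) {t : ℝ} (ht : 0 < t) :
    (t : ℂ) * laplaceIntegral (a - 1 + 1 + 1) (b - a - 1) t
      - (b - t) * laplaceIntegral (a - 1 + 1) (b - a - 1) t
      - a * laplaceIntegral (a - 1) (b - a - 1) t = 0 := by
  set α := a - 1 with hα
  set β := b - a - 1 with hβ
  have h0 : -1 < α.re := by simp [hα]; linarith
  have h1 : -1 < (α + 1).re := by simp [hα]; linarith
  have h2 : -1 < (α + 1 + 1).re := by simp [hα]; linarith
  have ha0 : a ≠ 0 := by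
    rintro rfl
    simp at ha
  -- The combination in question is minus the integral of the derivative of `G(s) = e^{-ts} s^a
  -- (1+s)^{b-a}`. The boundary terms vanish: at `0` because `Re a > 0`, at infinity because `G` and
  -- `G'` are integrable.
  let G : ℝ → ℂ := laplaceIntegrand a (b - a) t
  let G' : ℝ → ℂ := fun s => -(t : ℂ) * laplaceIntegrand (α + 1 + 1) β t s
    + (b - t) * laplaceIntegrand (α + 1) β t s + a * laplaceIntegrand α β t s
  have i0 := (integrableOn_laplaceIntegrand h0 β ht).const_mul a
  have i1 := (integrableOn_laplaceIntegrand h1 β ht).const_mul (b - t)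
  have i2 := (integrableOn_laplaceIntegrand h2 β ht).const_mul (-(t : ℂ))
  have hGd : ∀ s ∈ Set.Ioi (0 : ℝ), HasDerivAt G (G' s) s := by
    intro s hs
    have hs' : (0 : ℝ) < s := hs
    have hs0 : (s : ℂ) ≠ 0 := by exact_mod_cast hs'.ne'
    have hs1 : (1 : ℂ) + (s : ℂ) ∈ Complex.slitPlane := by
      left
      simp only [Complex.add_re, Complex.one_re, Complex.ofReal_re]
      positivity
    have d1 : HasDerivAt (fun r : ℝ => -((t : ℂ) * (r : ℂ))) (-((t : ℂ) * 1)) s :=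
      ((Complex.ofRealCLM.hasDerivAt (x := s)).const_mul (t : ℂ)).neg
    have d2 := hasDerivAt_ofReal_cpow_const hs'.ne' ha0
    have d3 : HasDerivAt (fun r : ℝ => ((1 : ℂ) + (r : ℂ)) ^ (b - a))
        ((b - a) * ((1 : ℂ) + (s : ℂ)) ^ (b - a - 1) * 1) s :=
      (((hasDerivAt_id (s : ℂ)).const_add 1).cpow_const hs1).comp_ofReal
    refine ((d1.cexp.mul d2).mul d3).congr_deriv ?_
    simp only [G']
    rw [laplaceIntegrand_add_one _ _ _ hs', laplaceIntegrand_add_one _ _ _ hs', laplaceIntegrand]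
    have e1 : (s : ℂ) ^ a = s * (s : ℂ) ^ (a - 1) := by
      rw [Complex.cpow_sub _ _ hs0, Complex.cpow_one]
      field_simp
    have e2 : ((1 : ℂ) + (s : ℂ)) ^ (b - a) = (1 + s) * ((1 : ℂ) + (s : ℂ)) ^ (b - a - 1) := by
      rw [Complex.cpow_sub (b - a) 1 (Complex.slitPlane_ne_zero hs1), Complex.cpow_one]
      field_simp [Complex.slitPlane_ne_zero hs1]
    simp only [Pi.mul_apply]
    rw [e1, e2]
    ring
  have hG'i : IntegrableOn G' (Set.Ioi 0) := (i2.add i1).add i0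
  have hGi : IntegrableOn G (Set.Ioi 0) :=
    integrableOn_laplaceIntegrand (by linarith) (b - a) ht
  have hlim := tendsto_zero_of_hasDerivAt_of_integrableOn_Ioi hGd hG'i hGi
  have hcont : ContinuousWithinAt G (Set.Ici 0) 0 := by
    refine ContinuousAt.continuousWithinAt ?_
    refine (ContinuousAt.mul (by fun_prop)
      (Complex.continuousAt_ofReal_cpow_const _ _ (Or.inl ha))).mul ?_
    exact ContinuousAt.cpow (by fun_prop) continuousAt_const (by simp)
  have hint := integral_Ioi_of_hasDerivAt_of_tendsto hcont hGd hG'i hlim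
  have hG0 : G 0 = 0 := by simp [G, laplaceIntegrand, ha0]
  rw [hG0, sub_zero] at hint
  have hsum : ∫ s in Set.Ioi (0 : ℝ), G' s = -(t : ℂ) * laplaceIntegral (α + 1 + 1) β t
      + (b - t) * laplaceIntegral (α + 1) β t + a * laplaceIntegral α β t := by
    simp only [G', laplaceIntegral]
    have e1 := integral_add (i2.add i1) i0
    have e2 := integral_add i2 i1
    simp only [Pi.add_apply] at e1 e2
    rw [e1, e2, integral_const_mul, integral_const_mul,
      integral_const_mul]
  rw [hint] at hsum
  linear_combination hsum

theorem norm_laplaceIntegral_le {α : ℂ} (hα : -1 < α.re) (β : ℂ) {t : ℝ} (ht : 1 ≤ t) :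
    ‖laplaceIntegral α β t‖ ≤ ∫ s in Set.Ioi (0 : ℝ), ‖laplaceIntegrand α β 1 s‖ := by
  refine norm_integral_le_of_norm_le (integrableOn_laplaceIntegrand hα β one_pos).norm ?_
  refine (ae_restrict_iff' measurableSet_Ioi).mpr (ae_of_all _ fun s hs => ?_)
  have hs' : (0 : ℝ) < s := hs
  rw [norm_laplaceIntegrand _ _ _ hs', norm_laplaceIntegrand _ _ _ hs']
  gcongr

/-- Rescaling of the Laplace integral. -/
theorem cpow_mul_laplaceIntegral (α β : ℂ) {t : ℝ} (ht : 0 < t) :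
    (t : ℂ) ^ (α + 1) * laplaceIntegral α β t
      = ∫ r in Set.Ioi (0 : ℝ), ((Real.exp (-r) : ℝ) : ℂ) * (r : ℂ) ^ α
          * ((1 : ℂ) + ((r / t : ℝ) : ℂ)) ^ β := by
  have h := integral_comp_mul_left_Ioi (fun r : ℝ => ((Real.exp (-r) : ℝ) : ℂ) * (r : ℂ) ^ α
          * ((1 : ℂ) + ((r / t : ℝ) : ℂ)) ^ β) 0 ht
  have ht0 : (t : ℂ) ≠ 0 := by exact_mod_cast ht.ne'
  rw [mul_zero, Complex.real_smul, Complex.ofReal_inv] at h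
  have h' : ∫ s in Set.Ioi (0 : ℝ), ((Real.exp (-(t * s)) : ℝ) : ℂ) * ((t * s : ℝ) : ℂ) ^ α
          * ((1 : ℂ) + ((t * s / t : ℝ) : ℂ)) ^ β = (t : ℂ) ^ α * laplaceIntegral α β t := by
    rw [laplaceIntegral, ← integral_const_mul]
    refine setIntegral_congr_fun measurableSet_Ioi fun s hs => ?_
    have hs' : (0 : ℝ) < s := hs
    simp only [laplaceIntegrand]
    rw [mul_div_cancel_left₀ _ ht.ne', Complex.ofReal_mul,
      Complex.mul_cpow_ofReal_nonneg ht.le hs'.le]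
    push_cast
    ring
  rw [h'] at h
  rw [Complex.cpow_add _ _ ht0, Complex.cpow_one]
  field_simp at h
  linear_combination h

/-- A power is monotone in its base, in a direction given by the sign of `x`. Adding both end points
gives a dominating function that works for either sign. -/
theorem rpow_le_rpow_add_rpow {p q r : ℝ} (hp : 0 < p) (hpq : p ≤ q) (hqr : q ≤ r) (x : ℝ) :
    q ^ x ≤ r ^ x + p ^ x := by
  have hq : 0 < q := hp.trans_le hpq
  have hr : 0 < r := hq.trans_le hqr
  rcases le_total 0 x with hx | hx
  · exact (Real.rpow_le_rpow hq.le hqr hx).trans (le_add_of_nonneg_right (by positivity))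
  · exact (Real.rpow_le_rpow_of_nonpos hp hpq hx).trans (le_add_of_nonneg_left (by positivity))

/-- After `r = ts` the factor `(1 + r/t)^β` tends to `1` and Euler's integral remains. The limit is
non-zero, which shows that the integral defining `W` does not vanish identically. -/
theorem tendsto_cpow_mul_laplaceIntegral_atTop {a : ℂ} (ha : 0 < a.re) (β : ℂ) :
    Tendsto (fun t : ℝ => (t : ℂ) ^ (a - 1 + 1) * laplaceIntegral (a - 1) β t) atTop
      (𝓝 (Complex.Gamma a)) := by
  have hα : -1 < (a - 1).re := by simp; linarith
  have hlim : Tendsto (fun t : ℝ => ∫ r in Set.Ioi (0 : ℝ), ((Real.exp (-r) : ℝ) : ℂ)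
      * (r : ℂ) ^ (a - 1) * ((1 : ℂ) + ((r / t : ℝ) : ℂ)) ^ β) atTop
      (𝓝 (∫ r in Set.Ioi (0 : ℝ), ((Real.exp (-r) : ℝ) : ℂ) * (r : ℂ) ^ (a - 1))) := by
    refine tendsto_integral_filter_of_dominated_convergence
      (fun r => Real.exp (-(1 * r)) * r ^ (a - 1).re * (1 + r) ^ β.re
        + Real.exp (-(1 * r)) * r ^ (a - 1).re) ?_ ?_
      ((integrableOn_exp_rpow_one_add_rpow one_pos hα _).add (integrableOn_exp_rpow one_pos hα)) ?_
    · filter_upwards [eventually_gt_atTop 0] with t ht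
      refine ContinuousOn.aestronglyMeasurable (fun s hs => ?_) measurableSet_Ioi
      have hs' : (0 : ℝ) < s := hs
      refine ContinuousAt.continuousWithinAt ?_
      refine (ContinuousAt.mul (by fun_prop)
        (Complex.continuousAt_ofReal_cpow_const _ _ (Or.inr hs'.ne'))).mul ?_
      refine ContinuousAt.cpow (by fun_prop) continuousAt_const ?_
      left
      simp only [Complex.add_re, Complex.one_re, Complex.ofReal_re]
      positivity
    · filter_upwards [eventually_ge_atTop 1] with t ht
      refine (ae_restrict_iff' measurableSet_Ioi).mpr (ae_of_all _ fun s hs => ?_)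
      have hs' : (0 : ℝ) < s := hs
      have ht0 : (0 : ℝ) < t := by linarith
      have h1 : ((1 : ℂ) + ((s / t : ℝ) : ℂ)) = ((1 + s / t : ℝ) : ℂ) := by push_cast; rfl
      rw [norm_mul, norm_mul, h1, Complex.norm_cpow_eq_rpow_re_of_pos hs',
        Complex.norm_cpow_eq_rpow_re_of_pos (by positivity), Complex.norm_real,
        Real.norm_of_nonneg (Real.exp_pos _).le, one_mul]
      have := rpow_le_rpow_add_rpow (p := 1) (q := 1 + s / t) (r := 1 + s) one_pos
        (by have : 0 < s / t := by positivity
            linarith) (by have := div_le_self hs'.le ht; linarith) β.re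
      rw [Real.one_rpow] at this
      calc _ ≤ Real.exp (-s) * s ^ (a - 1).re * ((1 + s) ^ β.re + 1) := by gcongr
        _ = _ := by ring
    · refine (ae_restrict_iff' measurableSet_Ioi).mpr (ae_of_all _ fun s hs => ?_)
      have h1 : Tendsto (fun t : ℝ => ((s / t : ℝ) : ℂ)) atTop (𝓝 ((0 : ℝ) : ℂ)) :=
        (Complex.continuous_ofReal.tendsto 0).comp (tendsto_const_nhds.div_atTop tendsto_id)
      have h2 : Tendsto (fun t : ℝ => ((1 : ℂ) + ((s / t : ℝ) : ℂ)) ^ β) atTop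
          (𝓝 (((1 : ℂ) + ((0 : ℝ) : ℂ)) ^ β)) :=
        (h1.const_add 1).cpow tendsto_const_nhds (by simp)
      simpa using h2.const_mul (((Real.exp (-s) : ℝ) : ℂ) * (s : ℂ) ^ (a - 1))
  rw [Complex.Gamma_eq_integral ha]
  refine hlim.congr' ?_
  filter_upwards [eventually_gt_atTop 0] with t ht
  rw [cpow_mul_laplaceIntegral _ _ ht]

/-- After `r = ts` the integrand is `e^{-r} r^{a-1} (t + r)^{b-a-1}`, which tends to that of `Γ(b -
1)`. So the Laplace integral has a singularity `t^{1-b}` at `0`, and this separates it from Kummer's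
function. -/
theorem tendsto_cpow_mul_laplaceIntegral_zero {a b : ℂ} (ha : 0 < a.re) (hb : 1 < b.re) :
    Tendsto (fun t : ℝ => (t : ℂ) ^ (b - 1) * laplaceIntegral (a - 1) (b - a - 1) t) (𝓝[>] 0)
      (𝓝 (Complex.Gamma (b - 1))) := by
  have hα : -1 < (a - 1).re := by simp; linarith
  have hαβ : -1 < (a - 1).re + (b - a - 1).re := by simp; linarith
  have hlim : Tendsto (fun t : ℝ => ∫ r in Set.Ioi (0 : ℝ), ((Real.exp (-r) : ℝ) : ℂ)
      * (r : ℂ) ^ (a - 1) * ((t : ℂ) + (r : ℂ)) ^ (b - a - 1)) (𝓝[>] 0)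
      (𝓝 (∫ r in Set.Ioi (0 : ℝ), ((Real.exp (-r) : ℝ) : ℂ) * (r : ℂ) ^ (b - 1 - 1))) := by
    refine tendsto_integral_filter_of_dominated_convergence
      (fun r => Real.exp (-(1 * r)) * r ^ (a - 1).re * (1 + r) ^ (b - a - 1).re
        + Real.exp (-(1 * r)) * r ^ ((a - 1).re + (b - a - 1).re)) ?_ ?_
      ((integrableOn_exp_rpow_one_add_rpow one_pos hα _).add (integrableOn_exp_rpow one_pos hαβ)) ?_
    · filter_upwards [self_mem_nhdsWithin] with t ht
      have ht' : (0 : ℝ) < t := ht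
      refine ContinuousOn.aestronglyMeasurable (fun s hs => ?_) measurableSet_Ioi
      have hs' : (0 : ℝ) < s := hs
      refine ContinuousAt.continuousWithinAt ?_
      refine (ContinuousAt.mul (by fun_prop)
        (Complex.continuousAt_ofReal_cpow_const _ _ (Or.inr hs'.ne'))).mul ?_
      refine ContinuousAt.cpow (by fun_prop) continuousAt_const ?_
      left
      simp only [Complex.add_re, Complex.ofReal_re]
      positivity
    · filter_upwards [Ioc_mem_nhdsGT (zero_lt_one' ℝ)] with t ht
      refine (ae_restrict_iff' measurableSet_Ioi).mpr (ae_of_all _ fun s hs => ?_)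
      have hs' : (0 : ℝ) < s := hs
      have ht0 : (0 : ℝ) < t := ht.1
      have h1 : ((t : ℂ) + (s : ℂ)) = ((t + s : ℝ) : ℂ) := by push_cast; rfl
      rw [norm_mul, norm_mul, h1, Complex.norm_cpow_eq_rpow_re_of_pos hs',
        Complex.norm_cpow_eq_rpow_re_of_pos (by positivity), Complex.norm_real,
        Real.norm_of_nonneg (Real.exp_pos _).le, one_mul, Real.rpow_add hs']
      have := rpow_le_rpow_add_rpow (p := s) (q := t + s) (r := 1 + s) hs'
        (by linarith) (by linarith [ht.2]) (b - a - 1).re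
      calc _ ≤ Real.exp (-s) * s ^ (a - 1).re * ((1 + s) ^ (b - a - 1).re + s ^ (b - a - 1).re) := by
            gcongr
        _ = _ := by ring
    · refine (ae_restrict_iff' measurableSet_Ioi).mpr (ae_of_all _ fun s hs => ?_)
      have hs' : (0 : ℝ) < s := hs
      have hs0 : (s : ℂ) ≠ 0 := by exact_mod_cast hs'.ne'
      have h1 : Tendsto (fun t : ℝ => (t : ℂ)) (𝓝[>] 0) (𝓝 ((0 : ℝ) : ℂ)) :=
        (Complex.continuous_ofReal.tendsto 0).mono_left nhdsWithin_le_nhds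
      have h2 : Tendsto (fun t : ℝ => ((t : ℂ) + (s : ℂ)) ^ (b - a - 1)) (𝓝[>] 0)
          (𝓝 ((((0 : ℝ) : ℂ) + (s : ℂ)) ^ (b - a - 1))) :=
        (h1.add_const _).cpow tendsto_const_nhds (by simp [Complex.slitPlane, hs'])
      have h3 := h2.const_mul (((Real.exp (-s) : ℝ) : ℂ) * (s : ℂ) ^ (a - 1))
      have e : (s : ℂ) ^ (b - 1 - 1) = (s : ℂ) ^ (a - 1) * (s : ℂ) ^ (b - a - 1) := by
        rw [← Complex.cpow_add _ _ hs0]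
        ring_nf
      rw [e, ← mul_assoc]
      simpa using h3
  have hb' : 0 < (b - 1).re := by simp; linarith
  rw [Complex.Gamma_eq_integral hb']
  refine hlim.congr' ?_
  filter_upwards [self_mem_nhdsWithin] with t ht
  have ht' : (0 : ℝ) < t := ht
  have ht0 : (t : ℂ) ≠ 0 := by exact_mod_cast ht'.ne'
  have e : (t : ℂ) ^ (b - 1) = (t : ℂ) ^ (b - a - 1) * (t : ℂ) ^ (a - 1 + 1) := by
    rw [← Complex.cpow_add _ _ ht0]
    ring_nf
  rw [e, mul_assoc, cpow_mul_laplaceIntegral _ _ ht', ← integral_const_mul]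
  refine setIntegral_congr_fun measurableSet_Ioi fun s hs => ?_
  have hs' : (0 : ℝ) < s := hs
  have e2 : ((t : ℂ) + (s : ℂ)) = ((t : ℝ) : ℂ) * ((1 + s / t : ℝ) : ℂ) := by
    push_cast
    field_simp
  have e3 : ((1 : ℂ) + ((s / t : ℝ) : ℂ)) = ((1 + s / t : ℝ) : ℂ) := by push_cast; rfl
  rw [e2, e3, Complex.mul_cpow_ofReal_nonneg ht'.le (by positivity)]
  ring

/-! ### Subexponential functions -/

/-- `p(t) = O(e^{εt})` as `t → ∞`, for all `ε > 0`. -/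
def Subexp (p : ℝ → ℂ) : Prop :=
  ∀ ε : ℝ, 0 < ε → p =O[atTop] fun t : ℝ => Real.exp (ε * t)

namespace Subexp

variable {p q : ℝ → ℂ}

theorem mul (hp : Subexp p) (hq : Subexp q) : Subexp fun t => p t * q t := by
  intro ε hε
  refine ((hp (ε / 2) (by positivity)).mul (hq (ε / 2) (by positivity))).congr_right fun t => ?_
  rw [← Real.exp_add]
  ring_nf

theorem add (hp : Subexp p) (hq : Subexp q) : Subexp fun t => p t + q t :=
  fun ε hε => (hp ε hε).add (hq ε hε)

theorem sub (hp : Subexp p) (hq : Subexp q) : Subexp fun t => p t - q t :=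
  fun ε hε => (hp ε hε).sub (hq ε hε)

theorem congr (hp : Subexp p) (h : ∀ t, 0 < t → q t = p t) : Subexp q := by
  intro ε hε
  refine (hp ε hε).congr' ?_ EventuallyEq.rfl
  filter_upwards [eventually_gt_atTop 0] with t ht using (h t ht).symm

theorem of_isBigO_one (hp : p =O[atTop] fun _ => (1 : ℝ)) : Subexp p := by
  intro ε hε
  refine hp.trans (IsBigO.of_bound 1 ?_)
  filter_upwards [eventually_ge_atTop 0] with t ht
  rw [one_mul, norm_one, Real.norm_of_nonneg (Real.exp_pos _).le]
  exact Real.one_le_exp (by positivity)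

theorem const (c : ℂ) : Subexp fun _ => c :=
  of_isBigO_one (isBigO_const_const c one_ne_zero atTop)

theorem cpow (c : ℂ) : Subexp fun t => (t : ℂ) ^ c := by
  intro ε hε
  refine IsBigO.trans (IsBigO.of_bound 1 ?_) (isLittleO_rpow_exp_pos_mul_atTop c.re hε).isBigO
  filter_upwards [eventually_gt_atTop 0] with t ht
  rw [one_mul, Complex.norm_cpow_eq_rpow_re_of_pos ht, Real.norm_of_nonneg (by positivity)]

theorem id : Subexp fun t => (t : ℂ) := (cpow 1).congr fun _ _ => (Complex.cpow_one _).symm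

/-- The function `e^{t/2} t^c` is not subexponential. -/
theorem not_exp_mul_cpow (c : ℂ) :
    ¬ Subexp fun t => Complex.exp ((t : ℂ)) * (t : ℂ) ^ c := by
  intro h
  have h1 : Subexp fun t : ℝ => Complex.exp (t : ℂ) := by
    refine (h.mul (cpow (-c))).congr fun t ht => ?_
    have ht0 : (t : ℂ) ≠ 0 := by exact_mod_cast ht.ne'
    rw [mul_assoc, ← Complex.cpow_add _ _ ht0, add_neg_cancel, Complex.cpow_zero, mul_one]
  have h2 : (fun t : ℝ => Real.exp t) =O[atTop] fun t : ℝ => Real.exp (1 / 2 * t) := by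
    refine (h1 (1 / 2) (by norm_num)).norm_left.congr_left fun t => ?_
    rw [← Complex.ofReal_exp, Complex.norm_real, Real.norm_of_nonneg (Real.exp_pos _).le]
  rw [Real.isBigO_exp_comp_exp_comp] at h2
  refine not_isBoundedUnder_of_tendsto_atTop ?_ h2
  refine (tendsto_id.const_mul_atTop (by norm_num : (0 : ℝ) < 1 / 2)).congr fun t => ?_
  change 1 / 2 * t = t - 1 / 2 * t
  ring

end Subexp

/-- `f(t) = O(e^{-rt})` as `t → ∞`, for all `r < 1/2`. -/
def Decays (f : ℝ → ℂ) : Prop := Subexp fun t => Complex.exp ((t : ℂ) / 2) * f t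

theorem norm_exp_half (t : ℝ) : ‖Complex.exp ((t : ℂ) / 2)‖ = Real.exp (1 / 2 * t) := by
  rw [Complex.norm_exp, Complex.div_ofNat_re, Complex.ofReal_re]
  ring_nf

namespace Decays

variable {f g p : ℝ → ℂ}

theorem isBigO (hf : Decays f) {r : ℝ} (hr : r < 1 / 2) :
    f =O[atTop] fun t => Real.exp (-r * t) := by
  have h := (hf (1 / 2 - r) (by linarith)).norm_left.mul
    (isBigO_refl (fun t : ℝ => Real.exp (-(1 / 2) * t)) atTop)
  refine IsBigO.of_norm_left (h.congr (fun t => ?_) fun t => ?_)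
  · rw [norm_mul, norm_exp_half, mul_right_comm, ← Real.exp_add]
    ring_nf
    simp
  · rw [← Real.exp_add]
    ring_nf

theorem of_isBigO (h : ∀ r : ℝ, r < 1 / 2 → f =O[atTop] fun t => Real.exp (-r * t)) :
    Decays f := by
  intro ε hε
  have h1 := (isBigO_refl (fun t : ℝ => Real.exp (1 / 2 * t)) atTop).mul
    (h (1 / 2 - ε) (by linarith)).norm_left
  refine IsBigO.of_norm_left (h1.congr (fun t => ?_) fun t => ?_)
  · rw [norm_mul, norm_exp_half]
  · rw [← Real.exp_add]
    ring_nf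

theorem mul (hp : Subexp p) (hf : Decays f) : Decays fun t => p t * f t :=
  (Subexp.mul hp hf).congr fun t _ => by ring

theorem sub (hf : Decays f) (hg : Decays g) : Decays fun t => f t - g t :=
  (Subexp.sub hf hg).congr fun t _ => by ring

theorem congr (hf : Decays f) (h : ∀ t, 0 < t → g t = f t) : Decays g :=
  Subexp.congr hf fun t ht => by rw [h t ht]

end Decays

/-! ### Whittaker's differential equation -/

/-- The coefficient `Q` of Whittaker's equation `f'' = Q f`. -/
def whittakerCoeff (κ ν : ℂ) (t : ℝ) : ℂ :=
  1 / 4 - κ / (t : ℂ) - (1 / 4 - ν ^ 2) / (t : ℂ) ^ 2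

theorem continuousOn_whittakerCoeff (κ ν : ℂ) :
    ContinuousOn (whittakerCoeff κ ν) (Set.Ioi 0) := by
  intro t ht
  have ht0 : (t : ℂ) ≠ 0 := by exact_mod_cast (ne_of_gt ht : t ≠ 0)
  have ht2 : (t : ℂ) ^ 2 ≠ 0 := pow_ne_zero 2 ht0
  refine ContinuousAt.continuousWithinAt ?_
  unfold whittakerCoeff
  fun_prop (disch := assumption)

theorem tendsto_ofReal_inv_atTop : Tendsto (fun t : ℝ => ((t : ℂ))⁻¹) atTop (𝓝 0) := by
  have := (Complex.continuous_ofReal.tendsto 0).comp tendsto_inv_atTop_zero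
  simpa [Function.comp_def] using this

theorem whittakerCoeff_isBigO (κ ν : ℂ) :
    whittakerCoeff κ ν =O[atTop] fun _ => (1 : ℝ) := by
  have h1 := tendsto_ofReal_inv_atTop
  have h : Tendsto (whittakerCoeff κ ν) atTop (𝓝 (1 / 4 - κ * 0 - (1 / 4 - ν ^ 2) * 0 ^ 2)) := by
    refine ((tendsto_const_nhds.sub (h1.const_mul κ)).sub
      ((h1.pow 2).const_mul (1 / 4 - ν ^ 2))).congr fun t => ?_
    simp only [whittakerCoeff, div_eq_mul_inv, inv_pow]
  exact h.isBigO_one ℝ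

theorem hasDerivAt_exp_neg_half (t : ℝ) :
    HasDerivAt (fun s : ℝ => Complex.exp (-(s : ℂ) / 2)) (-(1 / 2) * Complex.exp (-(t : ℂ) / 2)) t := by
  have h1 : HasDerivAt (fun s : ℝ => -(s : ℂ) / 2) (-1 / 2) t :=
    (Complex.ofRealCLM.hasDerivAt (x := t)).neg.div_const 2
  refine h1.cexp.congr_deriv ?_
  ring

theorem hasDerivAt_ofReal_cpow {t : ℝ} (ht : 0 < t) (c : ℂ) :
    HasDerivAt (fun s : ℝ => (s : ℂ) ^ c) (c / t * (t : ℂ) ^ c) t := by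
  have ht0 : (t : ℂ) ≠ 0 := by exact_mod_cast ht.ne'
  have h : (t : ℂ) ∈ Complex.slitPlane := Or.inl (by simpa using ht)
  refine (((hasDerivAt_id (t : ℂ)).cpow_const h).comp_ofReal).congr_deriv ?_
  simp only [id]
  rw [Complex.cpow_sub _ _ ht0, Complex.cpow_one]
  field_simp

/-- A solution of Kummer's equation gives a solution of Whittaker's equation. -/
theorem isSol_of_kummer {κ ν : ℂ} {V V' V'' : ℝ → ℂ}
    (h1 : ∀ t : ℝ, 0 < t → HasDerivAt V (V' t) t) (h2 : ∀ t : ℝ, 0 < t → HasDerivAt V' (V'' t) t)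
    (hK : ∀ t : ℝ, 0 < t → (t : ℂ) * V'' t + (1 + 2 * ν - t) * V' t
      - (1 / 2 + ν - κ) * V t = 0) :
    IsSol (whittakerCoeff κ ν)
      (fun t => Complex.exp (-(t : ℂ) / 2) * (t : ℂ) ^ (1 / 2 + ν) * V t)
      (fun t => Complex.exp (-(t : ℂ) / 2) * (t : ℂ) ^ (1 / 2 + ν)
        * (V' t + (-(1 / 2) + (1 / 2 + ν) / (t : ℂ)) * V t)) := by
  intro t ht
  have ht0 : (t : ℂ) ≠ 0 := by exact_mod_cast ht.ne'
  have hE := (hasDerivAt_exp_neg_half t).mul (hasDerivAt_ofReal_cpow ht (1 / 2 + ν))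
  have hp : HasDerivAt (fun s : ℝ => -(1 / 2) + (1 / 2 + ν) / (s : ℂ))
      (-(1 / 2 + ν) / (t : ℂ) ^ 2) t := by
    have := ((hasDerivAt_inv ht0).comp_ofReal.const_mul (1 / 2 + ν)).const_add (-(1 / 2))
    refine this.congr_deriv ?_
    field_simp
  refine ⟨(hE.mul (h1 t ht)).congr_deriv ?_,
    (hE.mul ((h2 t ht).add (hp.mul (h1 t ht)))).congr_deriv ?_⟩
  · simp only [Pi.mul_apply]
    field_simp
    ring
  · simp only [Pi.mul_apply, Pi.add_apply, whittakerCoeff]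
    generalize (t : ℂ) ^ (1 / 2 + ν) = P
    field_simp
    linear_combination (16 * (t : ℂ) * P) * hK t ht

/-- The raising relation for Whittaker's equation. -/
theorem IsSol.raise {κ ν : ℂ} {f f' : ℝ → ℂ} (hf : IsSol (whittakerCoeff κ ν) f f') :
    IsSol (whittakerCoeff (κ + 1) ν) (fun t => ((t : ℂ) / 2 - κ) * f t - (t : ℂ) * f' t)
      (fun t => (1 / 2 - (t : ℂ) * whittakerCoeff κ ν t) * f t + ((t : ℂ) / 2 - κ - 1) * f' t) := by
  intro t ht
  have ht0 : (t : ℂ) ≠ 0 := by exact_mod_cast ht.ne'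
  obtain ⟨h1, h2⟩ := hf t ht
  have hid : HasDerivAt (fun s : ℝ => (s : ℂ)) 1 t := Complex.ofRealCLM.hasDerivAt (x := t)
  have hQ : HasDerivAt (fun s : ℝ => (s : ℂ) * whittakerCoeff κ ν s)
      (1 / 4 + (1 / 4 - ν ^ 2) / (t : ℂ) ^ 2) t := by
    have h3 := (((hid.const_mul (1 / 4)).sub_const κ).sub
      ((hasDerivAt_inv ht0).comp_ofReal.const_mul (1 / 4 - ν ^ 2)))
    refine (h3.congr_deriv ?_).congr_of_eventuallyEq ?_
    · field_simp
      ring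
    · filter_upwards [Ioi_mem_nhds ht] with s hs
      have hs0 : (s : ℂ) ≠ 0 := by exact_mod_cast (ne_of_gt hs : s ≠ 0)
      simp only [whittakerCoeff, Pi.sub_apply]
      field_simp
  refine ⟨((((hid.div_const 2).sub_const κ).mul h1).sub (hid.mul h2)).congr_deriv ?_,
    (((hQ.const_sub (1 / 2)).mul h1).add
      ((((hid.div_const 2).sub_const κ).sub_const 1).mul h2)).congr_deriv ?_⟩
  · ring
  · simp only [whittakerCoeff]
    field_simp
    ring

theorem Decays.deriv {κ ν : ℂ} {f f' : ℝ → ℂ} (hf : IsSol (whittakerCoeff κ ν) f f')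
    (hd : Decays f) : Decays f' :=
  Decays.of_isBigO fun _ hr => hf.deriv_isBigO (whittakerCoeff_isBigO κ ν) (hd.isBigO hr)

/-- Non-zero solutions of Whittaker's equation that decay at infinity. -/
def IsRecessive (κ ν : ℂ) (f : ℝ → ℂ) : Prop :=
  ∃ f' : ℝ → ℂ, IsSol (whittakerCoeff κ ν) f f' ∧ Decays f ∧ ∃ t : ℝ, 0 < t ∧ f t ≠ 0

/-- Decay passes to `f'` and survives multiplication by polynomials. Raising cannot annihilate `f`,
because its kernel is spanned by `e^{t/2} t^{-κ}`, which does not decay. -/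
theorem IsRecessive.raise {κ ν : ℂ} {f : ℝ → ℂ} (hf : IsRecessive κ ν f) :
    IsRecessive (κ + 1) ν fun t => ((t : ℂ) / 2 - κ) * f t - (t : ℂ) * deriv f t := by
  obtain ⟨f', hs, hd, t₁, ht₁, hne⟩ := hf
  have he : ∀ t : ℝ, 0 < t → ((t : ℂ) / 2 - κ) * f t - (t : ℂ) * deriv f t
      = ((t : ℂ) / 2 - κ) * f t - (t : ℂ) * f' t := fun t ht => by rw [(hs t ht).1.deriv]
  refine ⟨_, hs.raise.congr he fun _ _ => rfl, ?_, ?_⟩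
  · refine Decays.congr (Decays.sub (Decays.mul (p := fun t => (t : ℂ) / 2 - κ) ?_ hd)
      (Decays.mul Subexp.id (hd.deriv hs))) he
    exact ((Subexp.id.mul (Subexp.const (1 / 2))).congr fun t _ => by ring).sub (Subexp.const κ)
  · by_contra! hcon
    have hz : ∀ t : ℝ, 0 < t → (t : ℂ) * f' t = ((t : ℂ) / 2 - κ) * f t := fun t ht => by
      have := hcon t ht
      rw [he t ht] at this
      linear_combination -this
    -- The first order equation `t f' = (t/2 - κ) f` is integrated: `e^{-t/2} t^κ f` has derivative
    -- zero.
    have hconst : ∀ t : ℝ, 0 < t → Complex.exp (-(t : ℂ) / 2) * (t : ℂ) ^ κ * f t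
        = Complex.exp (-(t₁ : ℂ) / 2) * (t₁ : ℂ) ^ κ * f t₁ := by
      intro t ht
      have hder : ∀ r : ℝ, 0 < r →
          HasDerivAt (fun r : ℝ => Complex.exp (-(r : ℂ) / 2) * (r : ℂ) ^ κ * f r) 0 r := by
        intro r hr
        have hr0 : (r : ℂ) ≠ 0 := by exact_mod_cast hr.ne'
        refine (((hasDerivAt_exp_neg_half r).mul (hasDerivAt_ofReal_cpow hr κ)).mul
          (hs r hr).1).congr_deriv ?_
        simp only [Pi.mul_apply]
        generalize Complex.exp (-(r : ℂ) / 2) = E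
        generalize (r : ℂ) ^ κ = P
        field_simp
        linear_combination (2 * E * P) * hz r hr
      exact isOpen_Ioi.is_const_of_deriv_eq_zero (convex_Ioi (0 : ℝ)).isPreconnected
        (fun r hr => (hder r hr).differentiableAt.differentiableWithinAt)
        (fun r hr => (hder r hr).deriv) ht ht₁
    set C := Complex.exp (-(t₁ : ℂ) / 2) * (t₁ : ℂ) ^ κ * f t₁ with hC
    have hC0 : C ≠ 0 := by
      have ht0 : (t₁ : ℂ) ≠ 0 := by exact_mod_cast ht₁.ne'
      refine mul_ne_zero (mul_ne_zero (Complex.exp_ne_zero _) ?_) hne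
      rw [Complex.cpow_def_of_ne_zero ht0]
      exact Complex.exp_ne_zero _
    -- Since `f = C e^{t/2} t^{-κ}`, the decay of `f` says that `C e^t t^{-κ}` is subexponential.
    refine Subexp.not_exp_mul_cpow (-κ) (((Subexp.const C⁻¹).mul hd).congr fun t ht => ?_)
    have ht0 : (t : ℂ) ≠ 0 := by exact_mod_cast ht.ne'
    have h1 : (t : ℂ) ^ κ * (t : ℂ) ^ (-κ) = 1 := by
      rw [← Complex.cpow_add _ _ ht0, add_neg_cancel, Complex.cpow_zero]
    have h2 : Complex.exp (t : ℂ) * Complex.exp (-(t : ℂ) / 2) = Complex.exp ((t : ℂ) / 2) := by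
      rw [← Complex.exp_add]
      ring_nf
    have h3 := hconst t ht
    rw [eq_inv_mul_iff_mul_eq₀ hC0, ← h3, ← h2]
    linear_combination (Complex.exp (t : ℂ) * Complex.exp (-(t : ℂ) / 2) * f t) * h1

/-! ### The function `W` -/

theorem whittakerWIntegral_eq (κ ν : ℂ) (t : ℝ) : whittakerWIntegral κ ν t =
    Complex.exp (-(t : ℂ) / 2) * (t : ℂ) ^ (1 / 2 + ν)
      * ((Complex.Gamma (1 / 2 + ν - κ))⁻¹
        * laplaceIntegral (1 / 2 + ν - κ - 1) (1 + 2 * ν - (1 / 2 + ν - κ) - 1) t) := by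
  have e1 : 1 / 2 + ν - κ - 1 = ν - κ - 1 / 2 := by ring
  have e2 : 1 + 2 * ν - (1 / 2 + ν - κ) - 1 = ν + κ - 1 / 2 := by ring
  rw [e1, e2, whittakerWIntegral, laplaceIntegral]
  simp only [laplaceIntegrand]
  ring

theorem decays_exp_neg_half_mul {p : ℝ → ℂ} (hp : Subexp p) :
    Decays fun t => Complex.exp (-(t : ℂ) / 2) * p t :=
  hp.congr fun t _ => by
    rw [← mul_assoc, ← Complex.exp_add, neg_div, add_neg_cancel, Complex.exp_zero, one_mul]

/-- The Laplace integral solves Kummer's equation, is bounded for `t ≥ 1`, and is non-zero for some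
large `t` because `t^a` times it tends to `Γ(a)`. -/
theorem isRecessive_whittakerWIntegral {κ ν : ℂ} (h : 0 < (1 / 2 + ν - κ).re) :
    IsRecessive κ ν (whittakerWIntegral κ ν) := by
  set a := 1 / 2 + ν - κ with ha
  set β := 1 + 2 * ν - a - 1 with hβ
  have ha1 : -1 < (a - 1).re := by simp; linarith
  have ha2 : -1 < (a - 1 + 1).re := by simp; linarith
  have hΓ : Complex.Gamma a ≠ 0 := Complex.Gamma_ne_zero_of_re_pos h
  have hsol := isSol_of_kummer (κ := κ) (ν := ν)
    (V := fun t => (Complex.Gamma a)⁻¹ * laplaceIntegral (a - 1) β t)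
    (V' := fun t => (Complex.Gamma a)⁻¹ * -laplaceIntegral (a - 1 + 1) β t)
    (V'' := fun t => (Complex.Gamma a)⁻¹ * - -laplaceIntegral (a - 1 + 1 + 1) β t)
    (fun t ht => (hasDerivAt_laplaceIntegral ha1 β ht).const_mul _)
    (fun t ht => (hasDerivAt_laplaceIntegral ha2 β ht).neg.const_mul _)
    (fun t ht => by
      have := laplaceIntegral_kummer h (1 + 2 * ν) ht
      linear_combination (Complex.Gamma a)⁻¹ * this)
  refine ⟨_, hsol.congr (fun t _ => whittakerWIntegral_eq κ ν t) fun _ _ => rfl, ?_, ?_⟩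
  · have hJ : Subexp fun t => (Complex.Gamma a)⁻¹ * laplaceIntegral (a - 1) β t := by
      refine (Subexp.const _).mul (Subexp.of_isBigO_one (IsBigO.of_bound
        (∫ s in Set.Ioi (0 : ℝ), ‖laplaceIntegrand (a - 1) β 1 s‖) ?_))
      filter_upwards [eventually_ge_atTop 1] with t ht
      rw [norm_one, mul_one]
      exact norm_laplaceIntegral_le ha1 β ht
    refine (decays_exp_neg_half_mul ((Subexp.cpow (1 / 2 + ν)).mul hJ)).congr fun t _ => ?_
    rw [whittakerWIntegral_eq, mul_assoc]
  · have hlim := tendsto_cpow_mul_laplaceIntegral_atTop h β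
    obtain ⟨t, ht, ht0⟩ := ((hlim.eventually_ne hΓ).and (eventually_gt_atTop 0)).exists
    refine ⟨t, ht0, ?_⟩
    have htc : (t : ℂ) ≠ 0 := by exact_mod_cast ht0.ne'
    rw [whittakerWIntegral_eq]
    refine mul_ne_zero (mul_ne_zero (Complex.exp_ne_zero _) ?_)
      (mul_ne_zero (inv_ne_zero hΓ) (right_ne_zero_of_mul ht))
    rw [Complex.cpow_def_of_ne_zero htc]
    exact Complex.exp_ne_zero _

theorem isRecessive_whittakerWRaise {κ ν : ℂ} (h : 0 < (1 / 2 + ν - κ).re) (j : ℕ) :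
    IsRecessive (κ + j) ν (whittakerWRaise κ ν j) := by
  induction j with
  | zero => simpa [whittakerWRaise] using isRecessive_whittakerWIntegral h
  | succ j ih =>
    have := ih.raise
    rw [add_assoc] at this
    simpa [whittakerWRaise] using this

theorem isRecessive_whittakerW (κ ν : ℂ) : IsRecessive κ ν (whittakerW κ ν) := by
  have h : 0 < (1 / 2 + ν - (κ - (whittakerShift κ ν : ℂ))).re := by
    -- `⌊x⌋ + 1` exceeds `x`, and truncation by `toNat` can only increase it.
    have h1 : κ.re - ν.re - 1 / 2 < (whittakerShift κ ν : ℝ) := by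
      refine (Int.lt_floor_add_one _).trans_le ?_
      rw [whittakerShift]
      exact_mod_cast Int.self_le_toNat _
    simp only [Complex.sub_re, Complex.add_re, Complex.div_ofNat_re, Complex.one_re,
      Complex.natCast_re]
    linarith
  have := isRecessive_whittakerWRaise h (whittakerShift κ ν)
  rwa [sub_add_cancel] at this

/-! ### Kummer's function -/

/-- The coefficients of Kummer's series. -/
def kummerCoeff (a b : ℂ) (j : ℕ) : ℂ :=
  (ascPochhammer ℂ j).eval a / (ascPochhammer ℂ j).eval b / (Nat.factorial j : ℂ)

theorem hasSum_of_hasSum_succ {f : ℕ → ℂ} {s : ℂ} (h0 : f 0 = 0)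
    (h : HasSum (fun j => f (j + 1)) s) : HasSum f s := by
  simpa [h0] using (hasSum_nat_add_iff 1).mp h

section Kummer

variable {a b : ℂ}

theorem ascPochhammer_eval_ne_zero (hb : ∀ m : ℕ, b + m ≠ 0) (j : ℕ) :
    (ascPochhammer ℂ j).eval b ≠ 0 := by
  induction j with
  | zero => simp
  | succ j ih =>
    rw [ascPochhammer_succ_eval]
    exact mul_ne_zero ih (hb j)

theorem ascPochhammer_succ_eval_left (x : ℂ) (j : ℕ) :
    (ascPochhammer ℂ (j + 1)).eval x = x * (ascPochhammer ℂ j).eval (x + 1) := by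
  rw [ascPochhammer_succ_left]
  simp

theorem add_one_shift_ne_zero (hb : ∀ m : ℕ, b + m ≠ 0) (m : ℕ) : b + 1 + m ≠ 0 := by
  have := hb (m + 1)
  push_cast at this
  rwa [add_assoc, add_comm 1 (m : ℂ)]

/-- This recursion is Kummer's differential equation, read coefficient by coefficient. -/
theorem kummerCoeff_succ (hb : ∀ m : ℕ, b + m ≠ 0) (j : ℕ) :
    ((j : ℂ) + 1) * (b + j) * kummerCoeff a b (j + 1) = (a + j) * kummerCoeff a b j := by
  have h1 := ascPochhammer_eval_ne_zero hb j
  have h2 := hb j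
  have h3 : (Nat.factorial j : ℂ) ≠ 0 := by exact_mod_cast Nat.factorial_ne_zero j
  have h4 : (j : ℂ) + 1 ≠ 0 := Nat.cast_add_one_ne_zero j
  rw [kummerCoeff, kummerCoeff, ascPochhammer_succ_eval, ascPochhammer_succ_eval,
    Nat.factorial_succ]
  push_cast
  field_simp

/-- The coefficient form of `₁F₁(a; b)' = (a/b) ₁F₁(a+1; b+1)`. -/
theorem kummerCoeff_succ_shift (hb : ∀ m : ℕ, b + m ≠ 0) (j : ℕ) :
    ((j : ℂ) + 1) * kummerCoeff a b (j + 1) = a / b * kummerCoeff (a + 1) (b + 1) j := by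
  have h1 := ascPochhammer_eval_ne_zero (add_one_shift_ne_zero hb) j
  have h2 : b ≠ 0 := by simpa using hb 0
  have h3 : (Nat.factorial j : ℂ) ≠ 0 := by exact_mod_cast Nat.factorial_ne_zero j
  have h4 : (j : ℂ) + 1 ≠ 0 := Nat.cast_add_one_ne_zero j
  rw [kummerCoeff, kummerCoeff, ascPochhammer_succ_eval_left, ascPochhammer_succ_eval_left,
    Nat.factorial_succ]
  push_cast
  field_simp

/-- The ratios `(a + j)/(b + j)` tend to `1` and no denominator vanishes, so they are bounded.
Comparison with an exponential series gives convergence for all `t` and differentiation term by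
term. -/
theorem exists_norm_kummerCoeff_le (a : ℂ) (hb : ∀ m : ℕ, b + m ≠ 0) :
    ∃ K : ℝ, 0 ≤ K ∧ ∀ j : ℕ, ‖kummerCoeff a b j‖ ≤ K ^ j / (Nat.factorial j : ℝ) := by
  have hO : (fun j : ℕ => (a + j) / (b + j)) =O[atTop] fun _ : ℕ => (1 : ℝ) := by
    refine IsBigO.of_bound (1 + ‖a - b‖) ?_
    obtain ⟨N, hN⟩ := exists_nat_ge (‖b‖ + 1)
    filter_upwards [eventually_ge_atTop N] with j hj
    have hj' : (N : ℝ) ≤ j := by exact_mod_cast hj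
    have h1 : 1 ≤ ‖b + j‖ := by
      have h2 := norm_sub_norm_le (j : ℂ) (-b)
      rw [sub_neg_eq_add, norm_neg, Complex.norm_natCast, add_comm (j : ℂ)] at h2
      linarith
    have h2 : (a + j) / (b + j) = 1 + (a - b) / (b + j) := by
      have := hb j
      field_simp
      ring
    rw [norm_one, mul_one, h2]
    refine (norm_add_le _ _).trans ?_
    rw [norm_one, norm_div]
    gcongr
    exact div_le_self (norm_nonneg _) h1
  obtain ⟨C, hC⟩ := isBigO_one_nat_atTop_iff.mp hO
  have hC0 : 0 ≤ C := (norm_nonneg _).trans (hC 0)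
  refine ⟨C, hC0, fun j => ?_⟩
  rw [kummerCoeff, norm_div, Complex.norm_natCast]
  gcongr
  induction j with
  | zero => simp
  | succ j ih =>
    rw [ascPochhammer_succ_eval, ascPochhammer_succ_eval, mul_div_mul_comm, norm_mul, pow_succ]
    exact mul_le_mul ih (hC j) (norm_nonneg _) (by positivity)

theorem hasSum_kummer (a : ℂ) (hb : ∀ m : ℕ, b + m ≠ 0) (t : ℝ) :
    HasSum (fun j : ℕ => kummerCoeff a b j * (t : ℂ) ^ j) (kummer a b t) := by
  obtain ⟨K, hK0, hK⟩ := exists_norm_kummerCoeff_le a hb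
  have hs : Summable fun j : ℕ => kummerCoeff a b j * (t : ℂ) ^ j := by
    refine Summable.of_norm_bounded (Real.summable_pow_div_factorial (K * |t|)) fun j => ?_
    rw [norm_mul, norm_pow, Complex.norm_real, Real.norm_eq_abs, mul_pow, mul_div_right_comm]
    gcongr
    exact hK j
  convert! hs.hasSum using 1
  rw [kummer]
  refine tsum_congr fun j => ?_
  rw [kummerCoeff]
  ring

theorem kummer_zero (a : ℂ) (hb : ∀ m : ℕ, b + m ≠ 0) : kummer a b 0 = 1 := by
  refine (hasSum_kummer a hb 0).unique ?_
  convert! hasSum_single (f := fun j : ℕ => kummerCoeff a b j * ((0 : ℝ) : ℂ) ^ j) 0 ?_ using 1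
  · simp [kummerCoeff]
  · intro j hj
    simp [hj]

theorem hasSum_kummer_deriv (a : ℂ) (hb : ∀ m : ℕ, b + m ≠ 0) (t : ℝ) :
    HasSum (fun j : ℕ => ((j : ℂ) + 1) * kummerCoeff a b (j + 1) * (t : ℂ) ^ j)
      (a / b * kummer (a + 1) (b + 1) t) := by
  refine ((hasSum_kummer (a + 1) (add_one_shift_ne_zero hb) t).mul_left (a / b)).congr_fun
    fun j => ?_
  rw [kummerCoeff_succ_shift hb]
  ring

theorem hasDerivAt_kummer (a : ℂ) (hb : ∀ m : ℕ, b + m ≠ 0) (t : ℝ) :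
    HasDerivAt (kummer a b) (a / b * kummer (a + 1) (b + 1) t) t := by
  obtain ⟨K, hK0, hK⟩ := exists_norm_kummerCoeff_le a hb
  set R : ℝ := |t| + 1 with hR
  have hu : Summable fun j : ℕ => K ^ j / (Nat.factorial j : ℝ) * (j * R ^ (j - 1)) := by
    rw [← summable_nat_add_iff 1]
    refine ((Real.summable_pow_div_factorial (K * R)).mul_left K).congr fun j => ?_
    rw [Nat.factorial_succ, Nat.add_sub_cancel]
    push_cast
    have h4 : (j : ℝ) + 1 ≠ 0 := Nat.cast_add_one_ne_zero j
    field_simp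
    ring_nf
  have hd := hasDerivAt_tsum_of_isPreconnected (t := Set.Ioo (-R) R) hu isOpen_Ioo
    isPreconnected_Ioo (g := fun j (s : ℝ) => kummerCoeff a b j * (s : ℂ) ^ j)
    (g' := fun j (s : ℝ) => kummerCoeff a b j * (j * (s : ℂ) ^ (j - 1))) (y₀ := t) (y := t)
    (fun j s _ => ?_) (fun j s hs => ?_) (abs_lt.mp (lt_add_one |t|))
    (hasSum_kummer a hb t).summable (abs_lt.mp (lt_add_one |t|))
  · have hfun : (fun s : ℝ => ∑' j : ℕ, kummerCoeff a b j * (s : ℂ) ^ j) = kummer a b := by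
      funext s
      exact (hasSum_kummer a hb s).tsum_eq
    rw [hfun] at hd
    refine hd.congr_deriv (HasSum.tsum_eq ?_)
    refine hasSum_of_hasSum_succ (by simp) ((hasSum_kummer_deriv a hb t).congr_fun fun j => ?_)
    rw [Nat.add_sub_cancel]
    push_cast
    ring
  · refine (((hasDerivAt_pow j (s : ℂ)).comp_ofReal).const_mul _)
  · rw [norm_mul, norm_mul, norm_pow, Complex.norm_real, Complex.norm_natCast, Real.norm_eq_abs]
    have : |s| ≤ R := (abs_lt.mpr hs).le
    gcongr
    exact hK j

/-- Kummer's differential equation. -/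
theorem kummer_ode (a : ℂ) (hb : ∀ m : ℕ, b + m ≠ 0) (t : ℝ) :
    (t : ℂ) * (a / b * ((a + 1) / (b + 1) * kummer (a + 1 + 1) (b + 1 + 1) t))
      + (b - t) * (a / b * kummer (a + 1) (b + 1) t) - a * kummer a b t = 0 := by
  have h0 := hasSum_kummer a hb t
  have h1 := hasSum_kummer_deriv a hb t
  have h2 := ((hasSum_kummer_deriv (a + 1) (add_one_shift_ne_zero hb) t).mul_left (a / b)).mul_left
    (t : ℂ)
  -- Multiplication by `t` shifts the series by one index, so that all terms of the equation are
  -- sums over the same powers of `t`.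
  have h1' : HasSum (fun j : ℕ => (j : ℂ) * kummerCoeff a b j * (t : ℂ) ^ j)
      (t * (a / b * kummer (a + 1) (b + 1) t)) := by
    refine hasSum_of_hasSum_succ (by simp) ((h1.mul_left (t : ℂ)).congr_fun fun j => ?_)
    push_cast
    ring
  have h2' : HasSum (fun j : ℕ => (j : ℂ) * ((j + 1) * kummerCoeff a b (j + 1)) * (t : ℂ) ^ j)
      (t * (a / b * ((a + 1) / (b + 1) * kummer (a + 1 + 1) (b + 1 + 1) t))) := by
    refine hasSum_of_hasSum_succ (by simp) (h2.congr_fun fun j => ?_)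
    have := kummerCoeff_succ_shift (a := a) hb (j + 1)
    rw [this]
    push_cast
    ring
  have h := ((h2'.add (h1.mul_left b)).sub h1').sub (h0.mul_left a)
  have hz : HasSum (fun _ : ℕ => (0 : ℂ)) _ := h.congr_fun fun j => by
    linear_combination (-(t : ℂ) ^ j) * kummerCoeff_succ (a := a) hb j
  linear_combination hz.unique hasSum_zero

end Kummer

/-! ### The function `M` -/

/-- The derivative is kept explicit because `Subexp.kummer_shift` extracts the contiguous Kummer
function from it. -/
theorem isSol_whittakerM (κ : ℂ) {ν : ℂ} (hν : ∀ m : ℕ, 1 + 2 * ν + m ≠ 0) :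
    ∃ M' : ℝ → ℂ, IsSol (whittakerCoeff κ ν) (whittakerM κ ν) M' ∧
      ∀ t : ℝ, M' t = Complex.exp (-(t : ℂ) / 2) * (t : ℂ) ^ (1 / 2 + ν)
        * ((1 / 2 + ν - κ) / (1 + 2 * ν) * kummer (1 / 2 + ν - κ + 1) (1 + 2 * ν + 1) t
          + (-(1 / 2) + (1 / 2 + ν) / (t : ℂ)) * kummer (1 / 2 + ν - κ) (1 + 2 * ν) t) := by
  refine ⟨_, isSol_of_kummer (fun t _ => hasDerivAt_kummer _ hν t)
    (fun t _ => (hasDerivAt_kummer _ (add_one_shift_ne_zero hν) t).const_mul _)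
    (fun t _ => kummer_ode _ hν t), fun t => rfl⟩

theorem decays_whittakerM_iff (κ ν : ℂ) :
    Decays (whittakerM κ ν) ↔ Subexp (kummer (1 / 2 + ν - κ) (1 + 2 * ν)) := by
  constructor
  · intro h
    refine ((Subexp.cpow (-(1 / 2 + ν))).mul h).congr fun t ht => ?_
    have ht0 : (t : ℂ) ≠ 0 := by exact_mod_cast ht.ne'
    have h1 : (t : ℂ) ^ (1 / 2 + ν) * (t : ℂ) ^ (-(1 / 2 + ν)) = 1 := by
      rw [← Complex.cpow_add _ _ ht0, add_neg_cancel, Complex.cpow_zero]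
    have h2 : Complex.exp ((t : ℂ) / 2) * Complex.exp (-(t : ℂ) / 2) = 1 := by
      rw [← Complex.exp_add, neg_div, add_neg_cancel, Complex.exp_zero]
    rw [whittakerM]
    linear_combination -(Complex.exp ((t : ℂ) / 2) * Complex.exp (-(t : ℂ) / 2)
      * kummer (1 / 2 + ν - κ) (1 + 2 * ν) t) * h1 - kummer (1 / 2 + ν - κ) (1 + 2 * ν) t * h2
  · intro h
    refine (decays_exp_neg_half_mul ((Subexp.cpow (1 / 2 + ν)).mul h)).congr fun t _ => ?_
    rw [whittakerM, mul_assoc]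

/-- If `₁F₁` were subexponential, `M` would decay and hence be a multiple of the decaying `W`; so
`₁F₁` would be a multiple of the Laplace integral. Near `0` the latter is of size `t^{1-b}` with `Re
b > 1`, while `₁F₁ → 1`. This forces the multiple to be zero, which is absurd. -/
theorem not_subexp_kummer_of_re_pos {a b : ℂ} (ha : 0 < a.re) (hb : 1 < b.re) :
    ¬ Subexp (kummer a b) := by
  intro h
  -- Every pair `(a, b)` has the form `(1/2 + ν - κ, 1 + 2ν)`, so the results on Whittaker's
  -- equation apply.
  set ν : ℂ := (b - 1) / 2 with hνdef
  set κ : ℂ := 1 / 2 + ν - a with hκdef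
  have hb' : 1 + 2 * ν = b := by rw [hνdef]; ring
  have ha' : 1 / 2 + ν - κ = a := by rw [hκdef]; ring
  have hbm : ∀ m : ℕ, b + m ≠ 0 := by
    intro m hm
    have := congrArg Complex.re hm
    simp only [Complex.add_re, Complex.natCast_re, Complex.zero_re] at this
    have hm0 : (0 : ℝ) ≤ m := m.cast_nonneg
    linarith
  obtain ⟨M', hM, -⟩ := isSol_whittakerM κ (ν := ν) (by rwa [hb'])
  have hMd : Decays (whittakerM κ ν) := (decays_whittakerM_iff κ ν).mpr (by rwa [ha', hb'])
  obtain ⟨W', hW, hWd, t₁, ht₁, hne⟩ := isRecessive_whittakerWIntegral (κ := κ) (ν := ν)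
    (by rwa [ha'])
  obtain ⟨A, hA⟩ := hM.exists_smul_of_isBigO hW (continuousOn_whittakerCoeff κ ν)
    (whittakerCoeff_isBigO κ ν) (c := -(1 / 4)) (d := 1 / 3) (by norm_num)
    (hMd.isBigO (by norm_num)) (hWd.isBigO (by norm_num)) ht₁ hne
  have hk : ∀ t : ℝ, 0 < t → kummer a b t
      = A * ((Complex.Gamma a)⁻¹ * laplaceIntegral (a - 1) (b - a - 1) t) := by
    intro t ht
    have ht0 : (t : ℂ) ≠ 0 := by exact_mod_cast ht.ne'
    have hE : Complex.exp (-(t : ℂ) / 2) * (t : ℂ) ^ (1 / 2 + ν) ≠ 0 := by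
      refine mul_ne_zero (Complex.exp_ne_zero _) ?_
      rw [Complex.cpow_def_of_ne_zero ht0]
      exact Complex.exp_ne_zero _
    have := hA t ht
    rw [whittakerWIntegral_eq, whittakerM, ha', hb'] at this
    refine mul_left_cancel₀ hE ?_
    linear_combination this
  have hcont : Tendsto (kummer a b) (𝓝[>] 0) (𝓝 1) := by
    have := (hasDerivAt_kummer a hbm 0).continuousAt.tendsto
    rw [kummer_zero a hbm] at this
    exact this.mono_left nhdsWithin_le_nhds
  have hpow : Tendsto (fun t : ℝ => (t : ℂ) ^ (b - 1)) (𝓝[>] 0) (𝓝 0) := by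
    have hre : 0 < (b - 1).re := by simp; linarith
    have hb0 : b - 1 ≠ 0 := by
      intro h0
      rw [h0] at hre
      simp at hre
    have := (Complex.continuousAt_ofReal_cpow_const 0 (b - 1) (Or.inl hre)).tendsto
    rw [Complex.ofReal_zero, Complex.zero_cpow hb0] at this
    exact this.mono_left nhdsWithin_le_nhds
  have h1 := hpow.mul hcont
  have h2 := (tendsto_cpow_mul_laplaceIntegral_zero ha hb).const_mul (A * (Complex.Gamma a)⁻¹)
  have h3 := tendsto_nhds_unique_of_eventuallyEq h1 h2 (by
    filter_upwards [self_mem_nhdsWithin] with t ht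
    rw [hk t ht]
    ring)
  have hΓ : Complex.Gamma (b - 1) ≠ 0 := Complex.Gamma_ne_zero_of_re_pos (by simp; linarith)
  have hA0 : A * (Complex.Gamma a)⁻¹ = 0 := by
    refine (mul_eq_zero.mp ?_).resolve_right hΓ
    rw [← h3]
    ring
  have h4 : Tendsto (kummer a b) (𝓝[>] 0) (𝓝 0) := by
    refine tendsto_const_nhds.congr' ?_
    filter_upwards [self_mem_nhdsWithin] with t ht
    rw [hk t ht, ← mul_assoc, hA0, zero_mul]
  exact one_ne_zero (tendsto_nhds_unique hcont h4)

/-- Subexponential `₁F₁(a; b)` means that `M` decays, hence so does `M'`. The formula for `M'` is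
then solved for `₁F₁(a+1; b+1)`, which needs `a ≠ 0`. -/
theorem Subexp.kummer_shift {a b : ℂ} (ha : a ≠ 0) (hb : ∀ m : ℕ, b + m ≠ 0)
    (h : Subexp (kummer a b)) : Subexp (kummer (a + 1) (b + 1)) := by
  have hb0 : b ≠ 0 := by simpa using hb 0
  set ν : ℂ := (b - 1) / 2 with hνdef
  set κ : ℂ := 1 / 2 + ν - a with hκdef
  have hb' : 1 + 2 * ν = b := by rw [hνdef]; ring
  have ha' : 1 / 2 + ν - κ = a := by rw [hκdef]; ring
  obtain ⟨M', hM, hM'⟩ := isSol_whittakerM κ (ν := ν) (by rwa [hb'])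
  have hMd : Decays (whittakerM κ ν) := (decays_whittakerM_iff κ ν).mpr (by rwa [ha', hb'])
  have h1 := (Subexp.cpow (-(1 / 2 + ν))).mul (hMd.deriv hM)
  have hp : Subexp fun t : ℝ => -(1 / 2) + (1 / 2 + ν) / (t : ℂ) := by
    refine (Subexp.const _).add (((Subexp.const (1 / 2 + ν)).mul (Subexp.cpow (-1))).congr
      fun t _ => ?_)
    rw [Complex.cpow_neg_one, div_eq_mul_inv]
  refine ((Subexp.const (b / a)).mul (h1.sub (hp.mul h))).congr fun t ht => ?_
  have ht0 : (t : ℂ) ≠ 0 := by exact_mod_cast ht.ne'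
  have e1 : (t : ℂ) ^ (1 / 2 + ν) * (t : ℂ) ^ (-(1 / 2 + ν)) = 1 := by
    rw [← Complex.cpow_add _ _ ht0, add_neg_cancel, Complex.cpow_zero]
  have e2 : Complex.exp ((t : ℂ) / 2) * Complex.exp (-(t : ℂ) / 2) = 1 := by
    rw [← Complex.exp_add, neg_div, add_neg_cancel, Complex.exp_zero]
  have e3 : (t : ℂ) ^ (-(1 / 2 + ν)) * (Complex.exp ((t : ℂ) / 2) * M' t)
      = a / b * kummer (a + 1) (b + 1) t
        + (-(1 / 2) + (1 / 2 + ν) / (t : ℂ)) * kummer a b t := by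
    rw [hM' t, ha', hb']
    linear_combination ((a / b * kummer (a + 1) (b + 1) t
        + (-(1 / 2) + (1 / 2 + ν) / (t : ℂ)) * kummer a b t)) *
          (Complex.exp ((t : ℂ) / 2) * Complex.exp (-(t : ℂ) / 2) * e1 + e2)
  rw [e3]
  field_simp
  ring

/-- Kummer's function grows exponentially, unless it is a polynomial. -/
theorem not_subexp_kummer {a b : ℂ} (ha : ∀ m : ℕ, a + m ≠ 0) (hb : ∀ m : ℕ, b + m ≠ 0) :
    ¬ Subexp (kummer a b) := by
  -- After `N` steps `(a, b) ↦ (a+1, b+1)` both real parts are in the range of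
  -- `not_subexp_kummer_of_re_pos`. The shift is allowed at each step since `a` never reaches `0`.
  obtain ⟨N, hN⟩ := exists_nat_gt (max (-a.re) (1 - b.re))
  have haN : 0 < a.re + N := by linarith [(le_max_left _ _).trans_lt hN]
  have hbN : 1 < b.re + N := by linarith [(le_max_right _ _).trans_lt hN]
  clear hN
  induction N generalizing a b with
  | zero => exact not_subexp_kummer_of_re_pos (by simpa using haN) (by simpa using hbN)
  | succ N ih =>
    intro h
    push_cast at haN hbN
    refine ih (add_one_shift_ne_zero ha) (add_one_shift_ne_zero hb) ?_ ?_
      (h.kummer_shift (by simpa using ha 0) hb)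
    · simp only [Complex.add_re, Complex.one_re]
      linarith
    · simp only [Complex.add_re, Complex.one_re]
      linarith

/-- The functions `W` and `M̃` form a fundamental system of Whittaker's equation. -/
theorem exists_fundamental_system {κ ν : ℂ} (hν : ∀ m : ℕ, 1 + 2 * ν + m ≠ 0)
    (hκ : ∀ m : ℕ, 1 / 2 + ν - κ + m ≠ 0) :
    ∃ W' M' : ℝ → ℂ, IsSol (whittakerCoeff κ ν) (whittakerWt κ ν) W' ∧
      IsSol (whittakerCoeff κ ν) (whittakerMt κ ν) M' ∧
      whittakerWt κ ν 1 * M' 1 - W' 1 * whittakerMt κ ν 1 ≠ 0 := by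
  obtain ⟨W', hW, hWd, t₁, ht₁, hne⟩ := isRecessive_whittakerW κ ν
  obtain ⟨M', hM, -⟩ := isSol_whittakerM κ hν
  set G := Complex.Gamma (1 / 2 + ν - κ) / Complex.Gamma (1 + 2 * ν) with hG
  have hG0 : G ≠ 0 := by
    refine div_ne_zero (Complex.Gamma_ne_zero fun m hm => hκ m ?_)
      (Complex.Gamma_ne_zero fun m hm => hν m ?_)
    · rw [hm, neg_add_cancel]
    · rw [hm, neg_add_cancel]
  refine ⟨W', fun t => G * M' t, hW, fun t ht => ⟨(hM t ht).1.const_mul G,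
    ((hM t ht).2.const_mul G).congr_deriv ?_⟩, fun h0 => ?_⟩
  · rw [whittakerMt]
    ring
  -- A vanishing Wronskian would make `M` a multiple of `W`, hence decaying, against the growth of
  -- Kummer's function.
  · have h1 : whittakerM κ ν 1 * W' 1 - M' 1 * whittakerW κ ν 1 = 0 := by
      rw [whittakerMt, ← hG, whittakerWt] at h0
      refine (mul_eq_zero.mp ?_).resolve_left hG0
      linear_combination -h0
    obtain ⟨A, hA⟩ := hM.exists_smul hW (continuousOn_whittakerCoeff κ ν) one_pos h1 ht₁ hne
    refine not_subexp_kummer hκ hν ((decays_whittakerM_iff κ ν).mp ?_)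
    exact (Decays.mul (Subexp.const A) hWd).congr hA

/-! ### Gradients on the upper half-plane -/

/-- The real linear form `v ↦ Re v · p + Im v · q`. -/
def gradForm (p q : ℂ) : ℂ →L[ℝ] ℂ :=
  Complex.reCLM.smulRight p + Complex.imCLM.smulRight q

theorem gradForm_apply (p q v : ℂ) : gradForm p q v = v.re * p + v.im * q := by
  simp [gradForm]

theorem eq_gradForm (L : ℂ →L[ℝ] ℂ) : L = gradForm (L 1) (L Complex.I) := by
  refine ContinuousLinearMap.ext fun v => ?_
  have h : v = (v.re : ℝ) • (1 : ℂ) + (v.im : ℝ) • Complex.I := by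
    simp [Complex.re_add_im]
  conv_lhs => rw [h]
  rw [map_add, map_smul, map_smul, gradForm_apply, Complex.real_smul, Complex.real_smul]

/-- The upper half-plane as a subset of `ℂ`. -/
def halfPlane : Set ℂ := {w : ℂ | 0 < w.im}

theorem isOpen_halfPlane : IsOpen halfPlane := isOpen_lt continuous_const Complex.continuous_im

/-- `f` has continuous partial derivatives `p` and `q` with respect to `x` and `y` on the upper
half-plane. -/
structure HasGrad (f p q : ℂ → ℂ) : Prop where
  hasFDerivAt : ∀ w ∈ halfPlane, HasFDerivAt f (gradForm (p w) (q w)) w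
  cont_x : ContinuousOn p halfPlane
  cont_y : ContinuousOn q halfPlane

namespace HasGrad

variable {f p q g r s : ℂ → ℂ}

theorem continuousOn (hf : HasGrad f p q) : ContinuousOn f halfPlane :=
  fun w hw => (hf.hasFDerivAt w hw).continuousAt.continuousWithinAt

theorem mul (hf : HasGrad f p q) (hg : HasGrad g r s) :
    HasGrad (fun w => f w * g w) (fun w => p w * g w + f w * r w)
      (fun w => q w * g w + f w * s w) := by
  refine ⟨fun w hw => ?_, (hf.cont_x.mul hg.continuousOn).add (hf.continuousOn.mul hg.cont_x),
    (hf.cont_y.mul hg.continuousOn).add (hf.continuousOn.mul hg.cont_y)⟩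
  refine ((hf.hasFDerivAt w hw).mul (hg.hasFDerivAt w hw)).congr_fderiv
    (ContinuousLinearMap.ext fun v => ?_)
  simp only [add_apply, smul_apply, gradForm_apply, smul_eq_mul]
  ring

theorem add (hf : HasGrad f p q) (hg : HasGrad g r s) :
    HasGrad (fun w => f w + g w) (fun w => p w + r w) (fun w => q w + s w) := by
  refine ⟨fun w hw => ?_, hf.cont_x.add hg.cont_x, hf.cont_y.add hg.cont_y⟩
  refine ((hf.hasFDerivAt w hw).add (hg.hasFDerivAt w hw)).congr_fderiv
    (ContinuousLinearMap.ext fun v => ?_)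
  simp only [add_apply, gradForm_apply]
  ring

theorem neg (hf : HasGrad f p q) :
    HasGrad (fun w => -f w) (fun w => -p w) (fun w => -q w) := by
  refine ⟨fun w hw => ?_, hf.cont_x.neg, hf.cont_y.neg⟩
  refine (hf.hasFDerivAt w hw).neg.congr_fderiv (ContinuousLinearMap.ext fun v => ?_)
  simp only [neg_apply, gradForm_apply]
  ring

theorem const_mul (hf : HasGrad f p q) (c : ℂ) :
    HasGrad (fun w => c * f w) (fun w => c * p w) (fun w => c * q w) := by
  refine ⟨fun w hw => ?_, continuousOn_const.mul hf.cont_x, continuousOn_const.mul hf.cont_y⟩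
  refine ((hf.hasFDerivAt w hw).const_mul c).congr_fderiv (ContinuousLinearMap.ext fun v => ?_)
  simp only [smul_apply, gradForm_apply, smul_eq_mul]
  ring

theorem cexp (hf : HasGrad f p q) : HasGrad (fun w => Complex.exp (f w))
    (fun w => p w * Complex.exp (f w)) (fun w => q w * Complex.exp (f w)) := by
  refine ⟨fun w hw => ?_, hf.cont_x.mul hf.continuousOn.cexp, hf.cont_y.mul hf.continuousOn.cexp⟩
  refine (hf.hasFDerivAt w hw).cexp.congr_fderiv (ContinuousLinearMap.ext fun v => ?_)
  simp only [smul_apply, gradForm_apply, smul_eq_mul]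
  ring

/-- The differential of a holomorphic `h` is multiplication by `h'`, so `∂_x h = h'` and `∂_y h = i
h'`. -/
theorem re {h h' : ℂ → ℂ} (hh : ∀ w ∈ halfPlane, HasDerivAt h (h' w) w)
    (hc : ContinuousOn h' halfPlane) :
    HasGrad (fun w => ((h w).re : ℂ)) (fun w => ((h' w).re : ℂ)) (fun w => -((h' w).im : ℂ)) := by
  refine ⟨fun w hw => ?_, by fun_prop, by fun_prop⟩
  refine ((Complex.ofRealCLM.comp Complex.reCLM).hasFDerivAt.comp w
    ((hh w hw).hasFDerivAt.restrictScalars ℝ)).congr_fderiv (ContinuousLinearMap.ext fun v => ?_)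
  simp only [gradForm_apply]
  simp
  ring

theorem im {h h' : ℂ → ℂ} (hh : ∀ w ∈ halfPlane, HasDerivAt h (h' w) w)
    (hc : ContinuousOn h' halfPlane) :
    HasGrad (fun w => ((h w).im : ℂ)) (fun w => ((h' w).im : ℂ)) (fun w => ((h' w).re : ℂ)) := by
  refine ⟨fun w hw => ?_, by fun_prop, by fun_prop⟩
  refine ((Complex.ofRealCLM.comp Complex.imCLM).hasFDerivAt.comp w
    ((hh w hw).hasFDerivAt.restrictScalars ℝ)).congr_fderiv (ContinuousLinearMap.ext fun v => ?_)
  simp only [gradForm_apply]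
  simp

theorem comp (hf : HasGrad f p q) {φ φ' : ℂ → ℂ} (hφ : ∀ w ∈ halfPlane, HasDerivAt φ (φ' w) w)
    (hc : ContinuousOn φ' halfPlane) (hm : Set.MapsTo φ halfPlane halfPlane) :
    HasGrad (fun w => f (φ w)) (fun w => (φ' w).re * p (φ w) + (φ' w).im * q (φ w))
      (fun w => -(φ' w).im * p (φ w) + (φ' w).re * q (φ w)) := by
  have hφc : ContinuousOn φ halfPlane := fun w hw => (hφ w hw).continuousAt.continuousWithinAt
  have hp : ContinuousOn (fun w => p (φ w)) halfPlane := hf.cont_x.comp hφc hm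
  have hq : ContinuousOn (fun w => q (φ w)) halfPlane := hf.cont_y.comp hφc hm
  have hr : ContinuousOn (fun w => ((φ' w).re : ℂ)) halfPlane :=
    (Complex.continuous_ofReal.comp Complex.continuous_re).comp_continuousOn hc
  have hi : ContinuousOn (fun w => ((φ' w).im : ℂ)) halfPlane :=
    (Complex.continuous_ofReal.comp Complex.continuous_im).comp_continuousOn hc
  refine ⟨fun w hw => ?_, (hr.mul hp).add (hi.mul hq),
    (hi.neg.mul hp).add (hr.mul hq)⟩
  refine ((hf.hasFDerivAt (φ w) (hm hw)).comp w
    ((hφ w hw).hasFDerivAt.restrictScalars ℝ)).congr_fderiv (ContinuousLinearMap.ext fun v => ?_)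
  simp [gradForm_apply]
  ring

theorem hasDerivAt_x (hf : HasGrad f p q) {x y : ℝ} (hy : 0 < y) :
    HasDerivAt (fun x : ℝ => f (x + y * Complex.I)) (p (x + y * Complex.I)) x := by
  have hw : (x + y * Complex.I : ℂ) ∈ halfPlane := by simpa [halfPlane] using hy
  have h1 : HasDerivAt (fun x : ℝ => (x + y * Complex.I : ℂ)) 1 x :=
    (Complex.ofRealCLM.hasDerivAt (x := x)).add_const _
  refine ((hf.hasFDerivAt _ hw).comp_hasDerivAt x h1).congr_deriv ?_
  simp [gradForm_apply]

theorem hasDerivAt_y (hf : HasGrad f p q) {x y : ℝ} (hy : 0 < y) :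
    HasDerivAt (fun y : ℝ => f (x + y * Complex.I)) (q (x + y * Complex.I)) y := by
  have hw : (x + y * Complex.I : ℂ) ∈ halfPlane := by simpa [halfPlane] using hy
  have h1 : HasDerivAt (fun y : ℝ => (x + y * Complex.I : ℂ)) (1 * Complex.I) y :=
    ((Complex.ofRealCLM.hasDerivAt (x := y)).mul_const _).const_add _
  refine ((hf.hasFDerivAt _ hw).comp_hasDerivAt y h1).congr_deriv ?_
  simp [gradForm_apply]

end HasGrad

/-- Twice continuously differentiable functions on the upper half-plane, with their partial
derivatives. -/
structure HasHessian (f f₁ f₂ f₁₁ f₁₂ f₂₁ f₂₂ : ℂ → ℂ) : Prop where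
  grad : HasGrad f f₁ f₂
  grad₁ : HasGrad f₁ f₁₁ f₁₂
  grad₂ : HasGrad f₂ f₂₁ f₂₂

theorem hasHessian_of_analytic {f : ℂ → ℂ} (hf : AnalyticOnNhd ℝ f halfPlane) :
    HasHessian f (fun w => fderiv ℝ f w 1) (fun w => fderiv ℝ f w Complex.I)
      (fun w => fderiv ℝ (fun z => fderiv ℝ f z 1) w 1)
      (fun w => fderiv ℝ (fun z => fderiv ℝ f z 1) w Complex.I)
      (fun w => fderiv ℝ (fun z => fderiv ℝ f z Complex.I) w 1)
      (fun w => fderiv ℝ (fun z => fderiv ℝ f z Complex.I) w Complex.I) := by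
  have hD : ∀ {g : ℂ → ℂ}, AnalyticOnNhd ℝ g halfPlane → ∀ v : ℂ,
      AnalyticOnNhd ℝ (fun w => fderiv ℝ g w v) halfPlane := fun hg v w hw =>
    ((ContinuousLinearMap.apply ℝ ℂ v).analyticAt _).comp (hg.fderiv w hw)
  have hG : ∀ {g : ℂ → ℂ}, AnalyticOnNhd ℝ g halfPlane →
      HasGrad g (fun w => fderiv ℝ g w 1) (fun w => fderiv ℝ g w Complex.I) := fun hg =>
    ⟨fun w hw => by
      rw [← eq_gradForm]
      exact (hg w hw).differentiableAt.hasFDerivAt, (hD hg 1).continuousOn, (hD hg _).continuousOn⟩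
  exact ⟨hG hf, hG (hD hf 1), hG (hD hf Complex.I)⟩

/-! ### The Laplace operator and the slash action -/

/-- The eigenvalue equation `Δ_k f = λ f`, in terms of partial derivatives. -/
def IsEigen (k ev : ℂ) (f f₁ f₁₁ f₂₂ : ℂ → ℂ) : Prop :=
  ∀ w ∈ halfPlane, -(w.im : ℂ) ^ 2 * (f₁₁ w + f₂₂ w) + Complex.I * k * w.im * f₁ w = ev * f w

/-- The Möbius transformation as a function on `ℂ`. -/
def moebius (g : SL(2, ℤ)) (w : ℂ) : ℂ :=
  (((g 0 0 : ℤ) : ℂ) * w + ((g 0 1 : ℤ) : ℂ)) / (((g 1 0 : ℤ) : ℂ) * w + ((g 1 1 : ℤ) : ℂ))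

/-- The factor `c w + d`, as a function on `ℂ`. -/
def jFactor (g : SL(2, ℤ)) (w : ℂ) : ℂ := ((g 1 0 : ℤ) : ℂ) * w + ((g 1 1 : ℤ) : ℂ)

theorem coe_smul_eq_moebius (g : SL(2, ℤ)) (z : ℍ) : ((g • z : ℍ) : ℂ) = moebius g z := by
  rw [coe_specialLinearGroup_apply, moebius]
  simp

theorem det_eq_one (g : SL(2, ℤ)) : g 0 0 * g 1 1 - g 0 1 * g 1 0 = 1 := by
  have := g.det_coe
  rwa [Matrix.det_fin_two] at this

theorem det_eq_one_complex (g : SL(2, ℤ)) :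
    ((g 0 0 : ℤ) : ℂ) * ((g 1 1 : ℤ) : ℂ) - ((g 0 1 : ℤ) : ℂ) * ((g 1 0 : ℤ) : ℂ) = 1 := by
  exact_mod_cast det_eq_one g

theorem jFactor_im (g : SL(2, ℤ)) (w : ℂ) : (jFactor g w).im = (g 1 0 : ℤ) * w.im := by
  simp [jFactor]

theorem jFactor_ne_zero (g : SL(2, ℤ)) {w : ℂ} (hw : w ∈ halfPlane) : jFactor g w ≠ 0 := by
  intro h
  have h1 := congrArg Complex.im h
  rw [jFactor_im, Complex.zero_im] at h1
  have hc : g 1 0 = 0 := by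
    have := (mul_eq_zero.mp h1).resolve_right (ne_of_gt hw)
    exact_mod_cast this
  have hd : g 1 1 = 0 := by
    rw [jFactor, hc, Int.cast_zero, zero_mul, zero_add] at h
    exact_mod_cast h
  have := det_eq_one g
  rw [hc, hd] at this
  simp at this

theorem ofComplex_coe_of_mem {w : ℂ} (hw : w ∈ halfPlane) : ((ofComplex w : ℍ) : ℂ) = w := by
  rw [ofComplex_apply_of_im_pos hw]

theorem moebius_mem (g : SL(2, ℤ)) {w : ℂ} (hw : w ∈ halfPlane) : moebius g w ∈ halfPlane := by
  have h := (g • (ofComplex w : ℍ)).im_pos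
  rw [← coe_im, coe_smul_eq_moebius, ofComplex_coe_of_mem hw] at h
  exact h

theorem smul_ofComplex (g : SL(2, ℤ)) {w : ℂ} (hw : w ∈ halfPlane) :
    g • (ofComplex w : ℍ) = ofComplex (moebius g w) := by
  apply UpperHalfPlane.ext
  rw [coe_smul_eq_moebius, ofComplex_coe_of_mem hw, ofComplex_coe_of_mem (moebius_mem g hw)]

theorem hasDerivAt_jFactor (g : SL(2, ℤ)) (w : ℂ) :
    HasDerivAt (jFactor g) ((g 1 0 : ℤ) : ℂ) w := by
  change HasDerivAt (fun w => ((g 1 0 : ℤ) : ℂ) * w + ((g 1 1 : ℤ) : ℂ)) _ w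
  simpa using ((hasDerivAt_id w).const_mul ((g 1 0 : ℤ) : ℂ)).add_const ((g 1 1 : ℤ) : ℂ)

theorem hasDerivAt_moebius (g : SL(2, ℤ)) {w : ℂ} (hw : w ∈ halfPlane) :
    HasDerivAt (moebius g) (((jFactor g w) ^ 2)⁻¹) w := by
  have h1 : HasDerivAt (fun w => ((g 0 0 : ℤ) : ℂ) * w + ((g 0 1 : ℤ) : ℂ)) ((g 0 0 : ℤ) : ℂ) w := by
    simpa using ((hasDerivAt_id w).const_mul ((g 0 0 : ℤ) : ℂ)).add_const ((g 0 1 : ℤ) : ℂ)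
  have hj := jFactor_ne_zero g hw
  refine (h1.div (hasDerivAt_jFactor g w) hj).congr_deriv ?_
  rw [div_eq_iff (pow_ne_zero 2 hj), inv_mul_cancel₀ (pow_ne_zero 2 hj), jFactor]
  linear_combination det_eq_one_complex g

theorem hasDerivAt_moebius_deriv (g : SL(2, ℤ)) {w : ℂ} (hw : w ∈ halfPlane) :
    HasDerivAt (fun w => ((jFactor g w) ^ 2)⁻¹)
      (-2 * ((g 1 0 : ℤ) : ℂ) / (jFactor g w) ^ 3) w := by
  have hj := jFactor_ne_zero g hw
  refine (((hasDerivAt_jFactor g w).pow 2).inv (pow_ne_zero 2 hj)).congr_deriv ?_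
  simp only [Pi.pow_apply, Nat.cast_ofNat, Nat.add_one_sub_one, pow_one]
  field_simp

theorem hasDerivAt_logDeriv_jFactor (g : SL(2, ℤ)) {w : ℂ} (hw : w ∈ halfPlane) :
    HasDerivAt (fun w => ((g 1 0 : ℤ) : ℂ) / jFactor g w)
      (-(((g 1 0 : ℤ) : ℂ) / jFactor g w) ^ 2) w := by
  have hj := jFactor_ne_zero g hw
  refine (((hasDerivAt_jFactor g w).inv hj).const_mul ((g 1 0 : ℤ) : ℂ)).congr_deriv ?_
  field_simp

theorem continuousOn_logDeriv_jFactor (g : SL(2, ℤ)) :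
    ContinuousOn (fun w => ((g 1 0 : ℤ) : ℂ) / jFactor g w) halfPlane :=
  fun _ hw => (hasDerivAt_logDeriv_jFactor g hw).continuousAt.continuousWithinAt

theorem continuousOn_jFactor (g : SL(2, ℤ)) : ContinuousOn (jFactor g) halfPlane :=
  fun w _ => (hasDerivAt_jFactor g w).continuousAt.continuousWithinAt

/-- If `c ≠ 0`, the factor `c w + d` stays off the real axis and `arg` is the imaginary part of a
holomorphic logarithm. If `c = 0`, it is constant, so the cut of `arg` does no harm even when `d <
0`. -/
theorem hasGrad_arg_jFactor (g : SL(2, ℤ)) :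
    HasGrad (fun w => (Complex.arg (jFactor g w) : ℂ))
      (fun w => ((((g 1 0 : ℤ) : ℂ) / jFactor g w).im : ℂ))
      (fun w => ((((g 1 0 : ℤ) : ℂ) / jFactor g w).re : ℂ)) := by
  by_cases hc : g 1 0 = 0
  · have h1 : (fun w => (Complex.arg (jFactor g w) : ℂ))
        = fun _ => (Complex.arg ((g 1 1 : ℤ) : ℂ) : ℂ) := by
      funext z
      rw [jFactor, hc, Int.cast_zero, zero_mul, zero_add]
    simp only [h1, hc, Int.cast_zero, zero_div, Complex.zero_im, Complex.zero_re,
      Complex.ofReal_zero]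
    refine ⟨fun w _ => (hasFDerivAt_const _ w).congr_fderiv (ContinuousLinearMap.ext fun v => ?_),
      continuousOn_const, continuousOn_const⟩
    simp [gradForm_apply]
  · have hl : ∀ w ∈ halfPlane, HasDerivAt (fun w => Complex.log (jFactor g w))
        (((g 1 0 : ℤ) : ℂ) / jFactor g w) w := by
      intro w hw
      refine (hasDerivAt_jFactor g w).clog (Or.inr ?_)
      rw [jFactor_im]
      exact mul_ne_zero (by exact_mod_cast hc) (ne_of_gt hw)
    have := HasGrad.im hl (continuousOn_logDeriv_jFactor g)
    simpa only [Complex.log_im] using this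

/-- The slash action, in terms of functions on `ℂ`. -/
def slashC (k : ℂ) (g : SL(2, ℤ)) (f : ℂ → ℂ) (w : ℂ) : ℂ :=
  Complex.exp (-(Complex.I * k) * (Complex.arg (jFactor g w) : ℂ)) * f (moebius g w)

theorem slash_eq_slashC (k : ℂ) (g : SL(2, ℤ)) (u : ℍ → ℂ) (z : ℍ) :
    slash k g u z = slashC k g (fun w => u (ofComplex w)) z := by
  rw [slash, slashC, ← coe_smul_eq_moebius, ofComplex_apply, neg_mul]
  rfl

theorem moebius_im (g : SL(2, ℤ)) {w : ℂ} (hw : w ∈ halfPlane) :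
    (moebius g w).im = w.im * (Complex.normSq (jFactor g w))⁻¹ := by
  have hj := jFactor_ne_zero g hw
  have hn : Complex.normSq (jFactor g w) ≠ 0 := by rwa [Ne, Complex.normSq_eq_zero]
  have hd : ((g 0 0 : ℤ) : ℝ) * ((g 1 1 : ℤ) : ℝ) - ((g 0 1 : ℤ) : ℝ) * ((g 1 0 : ℤ) : ℝ) = 1 := by
    exact_mod_cast det_eq_one g
  rw [moebius, Complex.div_im]
  change _ / Complex.normSq (jFactor g w) - _ / Complex.normSq (jFactor g w) = _
  field_simp
  simp
  linear_combination w.im * hd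

/-- Relations between the real and imaginary parts of `h = c / j`, of `j⁻²` and of `|j|⁻²`. -/
theorem jFactor_relations (g : SL(2, ℤ)) {w : ℂ} (hw : w ∈ halfPlane) :
    ((((jFactor g w) ^ 2)⁻¹.re : ℝ) : ℂ) ^ 2 + ((((jFactor g w) ^ 2)⁻¹.im : ℝ) : ℂ) ^ 2
        = (((Complex.normSq (jFactor g w))⁻¹ : ℝ) : ℂ) ^ 2 ∧
    (w.im : ℂ) ^ 2 * (((((g 1 0 : ℤ) : ℂ) / jFactor g w).re : ℂ) ^ 2
        + ((((g 1 0 : ℤ) : ℂ) / jFactor g w).im : ℂ) ^ 2)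
      + (w.im : ℂ) * ((((g 1 0 : ℤ) : ℂ) / jFactor g w).im : ℂ) = 0 ∧
    (2 * (w.im : ℂ) * ((((g 1 0 : ℤ) : ℂ) / jFactor g w).im : ℂ) + 1)
        * ((((jFactor g w) ^ 2)⁻¹.re : ℝ) : ℂ)
      - 2 * (w.im : ℂ) * ((((g 1 0 : ℤ) : ℂ) / jFactor g w).re : ℂ)
        * ((((jFactor g w) ^ 2)⁻¹.im : ℝ) : ℂ) = (((Complex.normSq (jFactor g w))⁻¹ : ℝ) : ℂ) ∧
    (2 * (w.im : ℂ) * ((((g 1 0 : ℤ) : ℂ) / jFactor g w).im : ℂ) + 1)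
        * ((((jFactor g w) ^ 2)⁻¹.im : ℝ) : ℂ)
      + 2 * (w.im : ℂ) * ((((g 1 0 : ℤ) : ℂ) / jFactor g w).re : ℂ)
        * ((((jFactor g w) ^ 2)⁻¹.re : ℝ) : ℂ) = 0 := by
  have hj := jFactor_ne_zero g hw
  have hn : Complex.normSq (jFactor g w) ≠ 0 := by rwa [Ne, Complex.normSq_eq_zero]
  have him := jFactor_im g w
  set j := jFactor g w
  set D := Complex.normSq j with hDdef
  have hD : D = j.re ^ 2 + j.im ^ 2 := by rw [hDdef, Complex.normSq_apply]; ring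
  have e1 : (j ^ 2)⁻¹.re = (j.re ^ 2 - j.im ^ 2) / D ^ 2 := by
    rw [Complex.inv_re, map_pow, pow_two j, Complex.mul_re]
    ring
  have e2 : (j ^ 2)⁻¹.im = -(2 * j.re * j.im) / D ^ 2 := by
    rw [Complex.inv_im, map_pow, pow_two j, Complex.mul_im]
    ring
  have e3 : (((g 1 0 : ℤ) : ℂ) / j).re = (g 1 0 : ℤ) * j.re / D := by
    rw [Complex.div_re]
    simp [hDdef]
  have e4 : (((g 1 0 : ℤ) : ℂ) / j).im = -((g 1 0 : ℤ) * j.im) / D := by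
    rw [Complex.div_im]
    simp [hDdef, neg_div]
  rw [e1, e2, e3, e4]
  norm_cast
  clear e1 e2 e3 e4
  clear_value D
  generalize j.re = p at *
  generalize j.im = q at *
  generalize ((g 1 0 : ℤ) : ℝ) = c at *
  -- With `Im j = c · Im w` inserted, the four relations are identities of rational functions in
  -- `c`, `Re j` and `Im w`.
  subst him
  refine ⟨?_, ?_, ?_, ?_⟩
  all_goals
    field_simp
    rw [hD]
    ring

/-- The slash action commutes with `Δ_k`. -/
theorem slashC_isEigen {k ev : ℂ} (g : SL(2, ℤ)) {f f₁ f₂ f₁₁ f₁₂ f₂₁ f₂₂ : ℂ → ℂ}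
    (hf : HasHessian f f₁ f₂ f₁₁ f₁₂ f₂₁ f₂₂) (he : IsEigen k ev f f₁ f₁₁ f₂₂) :
    ∃ F₁ F₂ F₁₁ F₁₂ F₂₁ F₂₂ : ℂ → ℂ, HasHessian (slashC k g f) F₁ F₂ F₁₁ F₁₂ F₂₁ F₂₂ ∧
      IsEigen k ev (slashC k g f) F₁ F₁₁ F₂₂ := by
  have hm : Set.MapsTo (moebius g) halfPlane halfPlane := fun w hw => moebius_mem g hw
  have hφ : ∀ w ∈ halfPlane, HasDerivAt (moebius g) (((jFactor g w) ^ 2)⁻¹) w :=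
    fun w hw => hasDerivAt_moebius g hw
  have hφ2 := fun w (hw : w ∈ halfPlane) => hasDerivAt_moebius_deriv g hw
  have hφ2c : ContinuousOn (fun w => -2 * ((g 1 0 : ℤ) : ℂ) / (jFactor g w) ^ 3) halfPlane :=
    continuousOn_const.div ((continuousOn_jFactor g).pow 3)
      fun w hw => pow_ne_zero 3 (jFactor_ne_zero g hw)
  have hφc : ContinuousOn (fun w => ((jFactor g w) ^ 2)⁻¹) halfPlane :=
    fun w hw => (hφ2 w hw).continuousAt.continuousWithinAt
  have hlog := fun w (hw : w ∈ halfPlane) => hasDerivAt_logDeriv_jFactor g hw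
  have hlogc := ((continuousOn_logDeriv_jFactor g).pow 2).neg
  have hP := HasGrad.re hφ2 hφ2c
  have hQ := HasGrad.im hφ2 hφ2c
  have hR := HasGrad.re hlog hlogc
  have hI := HasGrad.im hlog hlogc
  have hE := ((hasGrad_arg_jFactor g).const_mul (-(Complex.I * k))).cexp
  have hE1 := (hI.const_mul (-(Complex.I * k))).mul hE
  have hE2 := (hR.const_mul (-(Complex.I * k))).mul hE
  have hG := hf.grad.comp hφ hφc hm
  have hU1 := hf.grad₁.comp hφ hφc hm
  have hU2 := hf.grad₂.comp hφ hφc hm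
  have hG1 := (hP.mul hU1).add (hQ.mul hU2)
  have hG2 := (hQ.neg.mul hU1).add (hP.mul hU2)
  have hF := hE.mul hG
  have hF1 := (hE1.mul hG).add (hE.mul hG1)
  have hF2 := (hE2.mul hG).add (hE.mul hG2)
  refine ⟨_, _, _, _, _, _, ⟨hF, hF1, hF2⟩, fun w hw => ?_⟩
  have hj := jFactor_ne_zero g hw
  have hpde := he _ (hm hw)
  have him := moebius_im g hw
  have rels := jFactor_relations g hw
  set h := ((g 1 0 : ℤ) : ℂ) / jFactor g w with hh
  set φ' := ((jFactor g w) ^ 2)⁻¹ with hφ'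
  set N : ℝ := (Complex.normSq (jFactor g w))⁻¹ with hN
  obtain ⟨r1, r2, r3, r4⟩ := rels
  rw [him] at hpde
  simp only [slashC]
  push_cast at hpde
  set E := Complex.exp (-(Complex.I * k) * (Complex.arg (jFactor g w) : ℂ))
  set Z := moebius g w
  -- In `F₁₁ + F₂₂` the mixed derivatives `f₁₂`, `f₂₁` cancel without using their symmetry, and the
  -- second derivatives of the Möbius map and of `arg j` cancel because both are harmonic. Of the
  -- relations, `r1` treats the second order terms, `r2` the multiples of `f`, and `r3`, `r4` the
  -- multiples of `f₁` and `f₂`.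
  linear_combination E * hpde + (-(w.im : ℂ) ^ 2 * E * (f₁₁ Z + f₂₂ Z)) * r1
    + (-Complex.I ^ 2 * k ^ 2 * E * f Z) * r2 + (Complex.I * k * w.im * E * f₁ Z) * r3
    + (Complex.I * k * w.im * E * f₂ Z) * r4

variable {Γ : Subgroup SL(2, ℤ)} {k ev : ℂ} {v : Γ → ℂˣ} {u : ℍ → ℂ} {g : SL(2, ℤ)}

/-- The data of a generalized Maass form, in terms of functions on `ℂ`. -/
theorem IsGeneralizedMaassForm.exists_hasHessian (hu : IsGeneralizedMaassForm Γ k v ev u) :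
    ∃ f₁ f₂ f₁₁ f₁₂ f₂₁ f₂₂ : ℂ → ℂ,
      HasHessian (fun w => u (ofComplex w)) f₁ f₂ f₁₁ f₁₂ f₂₁ f₂₂ ∧
      IsEigen k ev (fun w => u (ofComplex w)) f₁ f₁₁ f₂₂ := by
  refine ⟨_, _, _, _, _, _, hasHessian_of_analytic hu.analytic, fun w hw => ?_⟩
  have h := hu.eigen (ofComplex w)
  have hev : ∀ᶠ z in 𝓝 w, ((ofComplex z : ℍ) : ℂ) = z := by
    filter_upwards [isOpen_halfPlane.mem_nhds hw] with z hz using ofComplex_coe_of_mem hz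
  have hx : (fun z => partialX u (ofComplex z))
      =ᶠ[𝓝 w] fun z => fderiv ℝ (fun z => u (ofComplex z)) z 1 := by
    filter_upwards [hev] with z hz
    rw [partialX, hz]
  have hy : (fun z => partialY u (ofComplex z))
      =ᶠ[𝓝 w] fun z => fderiv ℝ (fun z => u (ofComplex z)) z Complex.I := by
    filter_upwards [hev] with z hz
    rw [partialY, hz]
  have him : (ofComplex w : ℍ).im = w.im := by rw [← coe_im, ofComplex_coe_of_mem hw]
  rw [laplacian, partialX, partialX, partialY, ofComplex_coe_of_mem hw, hx.fderiv_eq, hy.fderiv_eq,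
    him] at h
  exact h

/-! ### Translations -/

theorem T_pow_smul_ofComplex (l : ℕ) {w : ℂ} (hw : w ∈ halfPlane) :
    ModularGroup.T ^ l • (ofComplex w : ℍ) = ofComplex (w + l) := by
  have hw' : w + l ∈ halfPlane := by simpa [halfPlane] using hw
  apply UpperHalfPlane.ext
  have := ModularGroup.coe_T_zpow_smul_eq (ofComplex w) (n := (l : ℤ))
  rw [zpow_natCast] at this
  rw [this, ofComplex_coe_of_mem hw, ofComplex_coe_of_mem hw']
  simp

theorem jFactor_mul (g h : SL(2, ℤ)) {w : ℂ} (hw : w ∈ halfPlane) :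
    jFactor (g * h) w = jFactor g (moebius h w) * jFactor h w := by
  have hj := jFactor_ne_zero h hw
  have e : moebius h w * jFactor h w = ((h 0 0 : ℤ) : ℂ) * w + ((h 0 1 : ℤ) : ℂ) :=
    div_mul_cancel₀ _ hj
  have e10 : (g * h) 1 0 = g 1 0 * h 0 0 + g 1 1 * h 1 0 := by
    simp [Matrix.mul_apply, Fin.sum_univ_two]
  have e11 : (g * h) 1 1 = g 1 0 * h 0 1 + g 1 1 * h 1 1 := by
    simp [Matrix.mul_apply, Fin.sum_univ_two]
  have hjh : jFactor h w = ((h 1 0 : ℤ) : ℂ) * w + ((h 1 1 : ℤ) : ℂ) := rfl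
  rw [jFactor, jFactor, add_mul, mul_assoc, e, e10, e11, hjh]
  push_cast
  ring

theorem jFactor_mul_T_pow (g : SL(2, ℤ)) (l : ℕ) (w : ℂ) :
    jFactor (g * ModularGroup.T ^ l) w = jFactor g (w + l) := by
  have hT := ModularGroup.coe_T_zpow (l : ℤ)
  rw [zpow_natCast] at hT
  have e10 : (g * ModularGroup.T ^ l) 1 0 = g 1 0 := by
    rw [Matrix.SpecialLinearGroup.coe_mul, hT]
    simp [Matrix.mul_apply, Fin.sum_univ_two]
  have e11 : (g * ModularGroup.T ^ l) 1 1 = g 1 0 * l + g 1 1 := by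
    rw [Matrix.SpecialLinearGroup.coe_mul, hT]
    simp [Matrix.mul_apply, Fin.sum_univ_two]
  rw [jFactor, jFactor, e10, e11]
  push_cast
  ring

/-- The imaginary part of `c l / j` is `-c² l Im w / |j|²`, whose sign does not depend on that of
`c`. -/
theorem jFactor_im_neg {g γ : SL(2, ℤ)} {l : ℕ} (hl : 0 < l) {w : ℂ} (hw : w ∈ halfPlane)
    (hc : g 1 0 ≠ 0)
    (hx : jFactor γ (moebius g w) = 1 + ((g 1 0 : ℤ) : ℂ) * l / jFactor g w) :
    (jFactor γ (moebius g w)).im < 0 := by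
  have hj := jFactor_ne_zero g hw
  have hn : 0 < Complex.normSq (jFactor g w) := Complex.normSq_pos.mpr hj
  have hc' : 0 < ((g 1 0 : ℤ) : ℝ) ^ 2 := by
    have : ((g 1 0 : ℤ) : ℝ) ≠ 0 := by exact_mod_cast hc
    positivity
  have hl' : (0 : ℝ) < l := by exact_mod_cast hl
  have hw0 : 0 < w.im := hw
  have e : (jFactor γ (moebius g w)).im
      = -(((g 1 0 : ℤ) : ℝ) ^ 2 * l * w.im) / Complex.normSq (jFactor g w) := by
    rw [hx, Complex.add_im, Complex.div_im, jFactor_im]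
    simp
    ring
  rw [e]
  exact div_neg_of_neg_of_pos (neg_neg_of_pos (by positivity)) hn

/-- The arguments of the factors of `j(γ g, w) = j(γ, g w) j(g, w)` add up, for `γ g = g T^l`. -/
theorem arg_jFactor_add {g γ : SL(2, ℤ)} {l : ℕ} (hl : 0 < l) (h : γ * g = g * ModularGroup.T ^ l)
    {w : ℂ} (hw : w ∈ halfPlane) :
    Complex.arg (jFactor g (w + l))
      = Complex.arg (jFactor γ (moebius g w)) + Complex.arg (jFactor g w) := by
  have hmul : jFactor g (w + l) = jFactor γ (moebius g w) * jFactor g w := by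
    rw [← jFactor_mul γ g hw, h, jFactor_mul_T_pow]
  have hj := jFactor_ne_zero g hw
  have hx0 := jFactor_ne_zero γ (moebius_mem g hw)
  have hadd : jFactor g (w + l) = jFactor g w + (g 1 0 : ℤ) * l := by
    rw [jFactor, jFactor]
    ring
  have hx : jFactor γ (moebius g w) = 1 + ((g 1 0 : ℤ) : ℂ) * l / jFactor g w := by
    rw [eq_comm, ← mul_left_inj' hj, ← hmul, hadd]
    field_simp
  have him := jFactor_im g w
  have him' : (jFactor g (w + l)).im = (g 1 0 : ℤ) * w.im := by
    rw [jFactor_im]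
    simp
  have hw0 : 0 < w.im := hw
  -- For `c > 0` one argument lies in `[0, π]` and the other in `(-π, 0)`, so the sum stays in `(-π,
  -- π]`. For `c < 0` this applies to `-j`, and the shift by `π` cancels. For `c = 0` the factor of
  -- `γ` is `1`.
  rcases lt_trichotomy (g 1 0) 0 with hc | hc | hc
  · have hc' : ((g 1 0 : ℤ) : ℝ) < 0 := by exact_mod_cast hc
    have h1 : (jFactor g w).im < 0 := by
      rw [him]
      exact mul_neg_of_neg_of_pos hc' hw0
    have h2 : (jFactor g (w + l)).im < 0 := by
      rw [him']
      exact mul_neg_of_neg_of_pos hc' hw0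
    have h3 : (jFactor γ (moebius g w)).im < 0 := jFactor_im_neg hl hw hc.ne hx
    have h4 := Complex.arg_neg_eq_arg_add_pi_of_im_neg h1
    have h5 := Complex.arg_neg_eq_arg_add_pi_of_im_neg h2
    have h6 : Complex.arg (jFactor γ (moebius g w) * -jFactor g w)
        = Complex.arg (jFactor γ (moebius g w)) + Complex.arg (-jFactor g w) := by
      refine Complex.arg_mul hx0 (neg_ne_zero.mpr hj) ⟨?_, ?_⟩
      · have a1 := Complex.neg_pi_lt_arg (jFactor γ (moebius g w))
        have a2 : 0 ≤ Complex.arg (-jFactor g w) := Complex.arg_nonneg_iff.mpr (by simp; linarith)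
        linarith
      · have a1 := Complex.arg_neg_iff.mpr h3
        have a2 := Complex.arg_le_pi (-jFactor g w)
        linarith
    rw [mul_neg, ← hmul] at h6
    linarith
  · rw [hx, hadd, hc]
    simp
  · have hc' : 0 < ((g 1 0 : ℤ) : ℝ) := by exact_mod_cast hc
    have h1 : 0 < (jFactor g w).im := by
      rw [him]
      exact mul_pos hc' hw0
    have h3 : (jFactor γ (moebius g w)).im < 0 := jFactor_im_neg hl hw hc.ne' hx
    rw [hmul]
    refine Complex.arg_mul hx0 hj ⟨?_, ?_⟩
    · have a1 := Complex.neg_pi_lt_arg (jFactor γ (moebius g w))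
      have a2 : 0 ≤ Complex.arg (jFactor g w) := Complex.arg_nonneg_iff.mpr h1.le
      linarith
    · have a1 := Complex.arg_neg_iff.mpr h3
      have a2 := Complex.arg_le_pi (jFactor g w)
      linarith

/-- Since `g(w + l) = γ g w`, the invariance of `u` under `γ` applies. Exact additivity of the
arguments leaves no stray factor `e^{±2πik}`, which would matter for non-integral `k`. -/
theorem slashC_add {γ : Γ} {l : ℕ} (hu : ∀ (γ : Γ) (z : ℍ), slash k (γ : SL(2, ℤ)) u z = (v γ : ℂ) * u z)
    (hl : 0 < l) (h : (γ : SL(2, ℤ)) * g = g * ModularGroup.T ^ l) {w : ℂ} (hw : w ∈ halfPlane) :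
    slashC k g (fun w => u (ofComplex w)) (w + l)
      = (v γ : ℂ) * slashC k g (fun w => u (ofComplex w)) w := by
  have hw' : w + l ∈ halfPlane := by simpa [halfPlane] using hw
  have h1 : ofComplex (moebius g (w + l)) = (γ : SL(2, ℤ)) • ofComplex (moebius g w) := by
    rw [← smul_ofComplex g hw', ← T_pow_smul_ofComplex l hw, ← smul_ofComplex g hw, smul_smul,
      smul_smul, h]
  have h2 := hu γ (ofComplex (moebius g w))
  have hc : cocycle (γ : SL(2, ℤ)) (ofComplex (moebius g w)) = jFactor γ (moebius g w) := by
    rw [cocycle, jFactor, ofComplex_coe_of_mem (moebius_mem g hw)]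
  rw [slash, hc] at h2
  simp only [slashC]
  rw [h1, arg_jFactor_add hl h hw]
  set x := Complex.arg (jFactor γ (moebius g w))
  set y := Complex.arg (jFactor g w)
  have e : Complex.exp (-(Complex.I * k) * ((x + y : ℝ) : ℂ))
      = Complex.exp (-(Complex.I * k) * (y : ℂ)) * Complex.exp (-(Complex.I * k * (x : ℂ))) := by
    rw [← Complex.exp_add]
    push_cast
    ring_nf
  rw [e, mul_assoc, h2]
  ring

theorem IsCuspGenerator.mul_eq {l : ℕ} {γ : Γ} (h : IsCuspGenerator Γ g l γ) :
    (γ : SL(2, ℤ)) * g = g * ModularGroup.T ^ l := by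
  rw [← h.conj_eq]
  group

/-! ### Growth -/

/-- For complex `k` the factor is not unimodular, but its modulus `e^{a Im k}` is bounded since
arguments are. So the slash action keeps the growth rate. -/
theorem norm_slash_factor_le (k : ℂ) (a : ℝ) (ha : |a| ≤ Real.pi) :
    ‖Complex.exp (-(Complex.I * k) * (a : ℂ))‖ ≤ Real.exp (|k.im| * Real.pi) := by
  rw [Complex.norm_exp, Real.exp_le_exp]
  have : (-(Complex.I * k) * (a : ℂ)).re = k.im * a := by simp
  rw [this]
  refine (le_abs_self _).trans ?_
  rw [abs_mul]
  gcongr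

theorem HasExpGrowthAt.slashC {c : ℝ} (hc : HasExpGrowthAt g u c) (X : ℝ) :
    ∃ C Y : ℝ, 0 < Y ∧ 0 ≤ C ∧ ∀ x y : ℝ, |x| ≤ X → Y ≤ y →
      ‖slashC k g (fun w => u (ofComplex w)) (x + y * Complex.I)‖ ≤ C * Real.exp (c * y) := by
  obtain ⟨C, hC0, hC⟩ := (hc X).exists_pos
  have h := hC.bound
  rw [Filter.eventually_inf_principal] at h
  obtain ⟨A, hA⟩ := (UpperHalfPlane.atImInfty_mem _).mp h
  refine ⟨Real.exp (|k.im| * Real.pi) * C, max A 1, by positivity, by positivity,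
    fun x y hx hy => ?_⟩
  have hy0 : 0 < y := one_pos.trans_le ((le_max_right _ _).trans hy)
  have hw : (x + y * Complex.I : ℂ) ∈ halfPlane := by simpa [halfPlane] using hy0
  have him : (ofComplex (x + y * Complex.I : ℂ) : ℍ).im = y := by
    rw [← coe_im, ofComplex_coe_of_mem hw]
    simp
  have hre : (ofComplex (x + y * Complex.I : ℂ) : ℍ).re = x := by
    rw [← coe_re, ofComplex_coe_of_mem hw]
    simp
  have h1 := hA (ofComplex (x + y * Complex.I : ℂ)) (by rw [him]; exact (le_max_left _ _).trans hy)
    (by simpa [hre] using hx)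
  rw [him, Real.norm_of_nonneg (Real.exp_pos _).le, smul_ofComplex g hw] at h1
  rw [GenMaass.slashC, norm_mul, mul_assoc]
  gcongr
  exact norm_slash_factor_le k _ (Complex.abs_arg_le_pi _)

/-! ### Fourier coefficients -/

/-- The integral `∫₀^l h(x + i y) e^{-iαx} dx`. -/
def fourierInt (l : ℕ) (α : ℝ) (h : ℂ → ℂ) (y : ℝ) : ℂ :=
  ∫ x in (0 : ℝ)..l, h (x + y * Complex.I) * Complex.exp (-(Complex.I * α * x))

theorem mem_halfPlane {x y : ℝ} (hy : 0 < y) : (x + y * Complex.I : ℂ) ∈ halfPlane := by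
  simpa [halfPlane] using hy

theorem continuous_horizontal {h : ℂ → ℂ} (hh : ContinuousOn h halfPlane) {y : ℝ} (hy : 0 < y) :
    Continuous fun x : ℝ => h (x + y * Complex.I) := by
  rw [← continuousOn_univ]
  exact hh.comp (by fun_prop) fun x _ => mem_halfPlane hy

theorem continuous_fourierInt_integrand {h : ℂ → ℂ} (hh : ContinuousOn h halfPlane) (α : ℝ) {y : ℝ}
    (hy : 0 < y) :
    Continuous fun x : ℝ => h (x + y * Complex.I) * Complex.exp (-(Complex.I * α * x)) :=
  (continuous_horizontal hh hy).mul (by fun_prop)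

theorem norm_exp_I_mul (α x : ℝ) : ‖Complex.exp (-(Complex.I * α * x))‖ = 1 := by
  rw [Complex.norm_exp]
  simp

theorem norm_fourierInt_le {l : ℕ} {h : ℂ → ℂ} {y C : ℝ} (α : ℝ)
    (hC : ∀ x : ℝ, 0 ≤ x → x ≤ l → ‖h (x + y * Complex.I)‖ ≤ C) :
    ‖fourierInt l α h y‖ ≤ C * l := by
  have hl : (0 : ℝ) ≤ l := l.cast_nonneg
  have := intervalIntegral.norm_integral_le_of_norm_le_const (a := (0 : ℝ)) (b := l)
    (f := fun x : ℝ => h (x + y * Complex.I) * Complex.exp (-(Complex.I * α * x))) (C := C)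
    (fun x hx => by
      rw [Set.uIoc_of_le hl] at hx
      rw [norm_mul, norm_exp_I_mul, mul_one]
      exact hC x hx.1.le hx.2)
  rwa [sub_zero, abs_of_nonneg hl] at this

theorem exists_norm_fourierInt_le (l : ℕ) {h : ℂ → ℂ} (hh : ContinuousOn h halfPlane) {y : ℝ}
    (hy : 0 < y) : ∃ C : ℝ, ∀ α : ℝ, ‖fourierInt l α h y‖ ≤ C := by
  obtain ⟨C, hC⟩ := isCompact_Icc.exists_bound_of_continuousOn
    (continuous_horizontal hh hy).continuousOn (s := Set.Icc (0 : ℝ) l)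
  exact ⟨C * l, fun α => norm_fourierInt_le α fun x h1 h2 => hC x ⟨h1, h2⟩⟩

/-- Continuity of `q` bounds it on the compact rectangle `[0, l] × [y/2, 2y]`, which allows
differentiation under the integral. -/
theorem HasGrad.hasDerivAt_fourierInt {h p q : ℂ → ℂ} (hh : HasGrad h p q) (l : ℕ) (α : ℝ) {y : ℝ}
    (hy : 0 < y) : HasDerivAt (fourierInt l α h) (fourierInt l α q y) y := by
  have hl : (0 : ℝ) ≤ l := l.cast_nonneg
  have hcont : ContinuousOn (fun r : ℝ × ℝ => q (r.1 + r.2 * Complex.I))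
      (Set.Icc 0 (l : ℝ) ×ˢ Set.Icc (y / 2) (2 * y)) := by
    refine hh.cont_y.comp (by fun_prop) fun r hr => mem_halfPlane ?_
    have := hr.2.1
    linarith
  obtain ⟨C, hC⟩ := (isCompact_Icc.prod isCompact_Icc).exists_bound_of_continuousOn hcont
  refine (intervalIntegral.hasDerivAt_integral_of_dominated_loc_of_deriv_le (μ := volume)
    (F := fun (y x : ℝ) => h (x + y * Complex.I) * Complex.exp (-(Complex.I * α * x)))
    (F' := fun (y x : ℝ) => q (x + y * Complex.I) * Complex.exp (-(Complex.I * α * x)))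
    (bound := fun _ => C) (s := Set.Ioo (y / 2) (2 * y)) (Ioo_mem_nhds (by linarith) (by linarith))
    ?_ ((continuous_fourierInt_integrand hh.continuousOn α hy).intervalIntegrable _ _)
    (continuous_fourierInt_integrand hh.cont_y α hy).aestronglyMeasurable
    (ae_of_all _ fun x hx r hr => ?_) intervalIntegrable_const (ae_of_all _ fun x _ r hr => ?_)).2
  · filter_upwards [Ioi_mem_nhds hy] with r hr
    exact (continuous_fourierInt_integrand hh.continuousOn α hr).aestronglyMeasurable
  · rw [Set.uIoc_of_le hl] at hx
    rw [norm_mul, norm_exp_I_mul, mul_one]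
    exact hC (x, r) ⟨⟨hx.1.le, hx.2⟩, ⟨hr.1.le, hr.2.le⟩⟩
  · have hr0 : 0 < r := by linarith [hr.1]
    exact (hh.hasDerivAt_y hr0).mul_const _

/-- Multiplication by `iα` corresponds to the derivative with respect to `x`. -/
theorem HasGrad.fourierInt_x {h p q : ℂ → ℂ} (hh : HasGrad h p q) {l : ℕ} {α : ℝ} {ε : ℂ}
    (hper : ∀ w ∈ halfPlane, h (w + l) = ε * h w) (hε : ε * Complex.exp (-(Complex.I * α * l)) = 1)
    {y : ℝ} (hy : 0 < y) : fourierInt l α p y = Complex.I * α * fourierInt l α h y := by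
  have hd : ∀ x : ℝ, HasDerivAt
      (fun x : ℝ => h (x + y * Complex.I) * Complex.exp (-(Complex.I * α * x)))
      (p (x + y * Complex.I) * Complex.exp (-(Complex.I * α * x))
        - Complex.I * α * (h (x + y * Complex.I) * Complex.exp (-(Complex.I * α * x)))) x := by
    intro x
    have h1 : HasDerivAt (fun x : ℝ => -(Complex.I * α * x)) (-(Complex.I * α * 1)) x :=
      ((Complex.ofRealCLM.hasDerivAt (x := x)).const_mul _).neg
    refine ((hh.hasDerivAt_x hy).mul h1.cexp).congr_deriv ?_
    ring
  have ip := (continuous_fourierInt_integrand hh.cont_x α hy).intervalIntegrable (μ := volume) 0 l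
  have ih := ((continuous_fourierInt_integrand hh.continuousOn α hy).const_mul
    (Complex.I * α)).intervalIntegrable (μ := volume) 0 l
  -- Integration by parts over one period; by `hε` the function `h e^{-iαx}` is `l`-periodic, so the
  -- boundary terms cancel.
  have hint := intervalIntegral.integral_eq_sub_of_hasDerivAt (a := (0 : ℝ)) (b := l)
    (fun x _ => hd x) (ip.sub ih)
  rw [intervalIntegral.integral_sub ip ih, intervalIntegral.integral_const_mul] at hint
  have hb : h (((l : ℝ) : ℂ) + y * Complex.I) = ε * h (((0 : ℝ) : ℂ) + y * Complex.I) := by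
    rw [← hper _ (mem_halfPlane hy)]
    push_cast
    ring_nf
  rw [hb] at hint
  change fourierInt l α p y - Complex.I * α * fourierInt l α h y = _ at hint
  rw [sub_eq_iff_eq_add] at hint
  rw [hint]
  simp only [Complex.ofReal_natCast, Complex.ofReal_zero, mul_zero, neg_zero, Complex.exp_zero]
  linear_combination (h (0 + y * Complex.I)) * hε

theorem HasGrad.add_period {h p q : ℂ → ℂ} (hh : HasGrad h p q) {l : ℕ} {ε : ℂ}
    (hper : ∀ w ∈ halfPlane, h (w + l) = ε * h w) : ∀ w ∈ halfPlane, p (w + l) = ε * p w := by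
  intro w hw
  have hy : 0 < w.im := hw
  have e1 : ∀ x : ℝ, ((x + l : ℝ) : ℂ) + w.im * Complex.I = (x + w.im * Complex.I) + l := by
    intro x
    push_cast
    ring
  have h1 : HasDerivAt (fun x : ℝ => h (((x + l : ℝ) : ℂ) + w.im * Complex.I))
      (p (((w.re + l : ℝ) : ℂ) + w.im * Complex.I)) w.re :=
    HasDerivAt.comp_add_const w.re (l : ℝ) (hh.hasDerivAt_x hy)
  have h2 := (hh.hasDerivAt_x (x := w.re) hy).const_mul ε
  have h3 : (fun x : ℝ => h (((x + l : ℝ) : ℂ) + w.im * Complex.I))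
      = fun x : ℝ => ε * h (x + w.im * Complex.I) := by
    funext x
    rw [e1, hper _ (mem_halfPlane hy)]
  rw [h3] at h1
  have h4 := h1.unique h2
  rwa [e1, Complex.re_add_im] at h4

section Eigen

variable {k ev ε : ℂ} {f f₁ f₂ f₁₁ f₁₂ f₂₁ f₂₂ : ℂ → ℂ} {l : ℕ}

/-- The Fourier coefficients of an eigenfunction satisfy a differential equation. -/
theorem isSol_fourierInt (hf : HasHessian f f₁ f₂ f₁₁ f₁₂ f₂₁ f₂₂) (he : IsEigen k ev f f₁ f₁₁ f₂₂)
    (hper : ∀ w ∈ halfPlane, f (w + l) = ε * f w) {α : ℝ}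
    (hε : ε * Complex.exp (-(Complex.I * α * l)) = 1) :
    IsSol (fun y => (α : ℂ) ^ 2 - k * α / y - ev / (y : ℂ) ^ 2) (fourierInt l α f)
      (fourierInt l α f₂) := by
  intro y hy
  have hy0 : (y : ℂ) ≠ 0 := by exact_mod_cast hy.ne'
  refine ⟨hf.grad.hasDerivAt_fourierInt l α hy,
    (hf.grad₂.hasDerivAt_fourierInt l α hy).congr_deriv ?_⟩
  have x1 := hf.grad.fourierInt_x hper hε hy
  have x2 := hf.grad₁.fourierInt_x (hf.grad.add_period hper) hε hy
  have i0 := (continuous_fourierInt_integrand hf.grad.continuousOn α hy).intervalIntegrable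
    (μ := volume) 0 l
  have i1 := (continuous_fourierInt_integrand hf.grad.cont_x α hy).intervalIntegrable
    (μ := volume) 0 l
  have i2 := (continuous_fourierInt_integrand hf.grad₁.cont_x α hy).intervalIntegrable
    (μ := volume) 0 l
  -- The eigenvalue equation, solved for the second `y`-derivative under the integral. The
  -- `x`-derivatives then become factors `iα`.
  have hpde : fourierInt l α f₂₂ y = Complex.I * k / y * fourierInt l α f₁ y
      - fourierInt l α f₁₁ y - ev / (y : ℂ) ^ 2 * fourierInt l α f y := by
    simp only [fourierInt]
    rw [← intervalIntegral.integral_const_mul, ← intervalIntegral.integral_const_mul,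
      ← intervalIntegral.integral_sub (i1.const_mul _) i2,
      ← intervalIntegral.integral_sub ((i1.const_mul _).sub i2) (i0.const_mul _)]
    refine intervalIntegral.integral_congr fun x _ => ?_
    have h := he _ (mem_halfPlane (x := x) hy)
    have him : (x + y * Complex.I : ℂ).im = y := by simp
    rw [him] at h
    generalize Complex.exp (-(Complex.I * α * x)) = E
    field_simp
    linear_combination (-E) * h
  rw [hpde, x2, x1]
  field_simp
  linear_combination (k * α * y - (α : ℂ) ^ 2 * y ^ 2) * fourierInt l α f y * Complex.I_sq

/-- Two integrations by parts in `x` give `α²` times the coefficient as a coefficient of `f₁₁`,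
which is bounded uniformly in `α`. This yields absolute convergence of the Fourier series. -/
theorem exists_sq_mul_norm_fourierInt_le (hf : HasHessian f f₁ f₂ f₁₁ f₁₂ f₂₁ f₂₂)
    (hper : ∀ w ∈ halfPlane, f (w + l) = ε * f w) {y : ℝ} (hy : 0 < y) :
    ∃ C : ℝ, ∀ α : ℝ, ε * Complex.exp (-(Complex.I * α * l)) = 1 →
      α ^ 2 * ‖fourierInt l α f y‖ ≤ C := by
  obtain ⟨C, hC⟩ := exists_norm_fourierInt_le l hf.grad₁.cont_x hy
  refine ⟨C, fun α hε => ?_⟩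
  have x1 := hf.grad.fourierInt_x hper hε hy
  have x2 := hf.grad₁.fourierInt_x (hf.grad.add_period hper) hε hy
  have h := hC α
  rw [x2, x1] at h
  simp only [norm_mul, Complex.norm_I, Complex.norm_real, one_mul, ← mul_assoc, Real.norm_eq_abs,
    mul_one, abs_mul_abs_self] at h
  rwa [pow_two]

end Eigen

theorem exp_mul_exp_frequency {l : ℕ} (hl : 0 < l) (κ : ℝ) (m : ℤ) :
    Complex.exp (2 * Real.pi * Complex.I * κ)
      * Complex.exp (-(Complex.I * ((2 * Real.pi * (κ + m) / l : ℝ) : ℂ) * l)) = 1 := by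
  have hl0 : (l : ℂ) ≠ 0 := by exact_mod_cast hl.ne'
  rw [← Complex.exp_add, Complex.exp_eq_one_iff]
  refine ⟨-m, ?_⟩
  push_cast
  field_simp
  ring

/-- The Fourier series of a function with `f(w + l) = e^{2πiκ} f(w)`. -/
theorem hasSum_fourierInt {f f₁ f₂ f₁₁ f₁₂ f₂₁ f₂₂ : ℂ → ℂ} {l : ℕ} (hl : 0 < l) {κ : ℝ}
    (hf : HasHessian f f₁ f₂ f₁₁ f₁₂ f₂₁ f₂₂)
    (hper : ∀ w ∈ halfPlane, f (w + l) = Complex.exp (2 * Real.pi * Complex.I * κ) * f w) {y : ℝ}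
    (hy : 0 < y) (x : ℝ) :
    HasSum (fun m : ℤ => (l : ℂ)⁻¹ * fourierInt l (2 * Real.pi * (κ + m) / l) f y
      * Complex.exp (2 * Real.pi * Complex.I * ((κ + m : ℝ) : ℂ) / l * x))
      (f (x + y * Complex.I)) := by
  have hl' : (0 : ℝ) < l := by exact_mod_cast hl
  have hl0 : (l : ℂ) ≠ 0 := by exact_mod_cast hl.ne'
  have : Fact ((0 : ℝ) < l) := ⟨hl'⟩
  -- Twisting by `e^{-2πiκx/l}` turns quasi-periodicity into periodicity, so that Fourier theory on
  -- the circle applies; the twist is undone at the end.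
  let φ : ℝ → ℂ := fun x =>
    f (x + y * Complex.I) * Complex.exp (-(2 * Real.pi * Complex.I * κ / l * x))
  have hφc : Continuous φ := (continuous_horizontal hf.grad.continuousOn hy).mul (by fun_prop)
  have hφp : Function.Periodic φ (l : ℝ) := by
    intro x
    have e1 : ((x + l : ℝ) : ℂ) + y * Complex.I = (x + y * Complex.I) + l := by
      push_cast
      ring
    have e2 : -(2 * Real.pi * Complex.I * κ / l * ((x + l : ℝ) : ℂ))
        = -(2 * Real.pi * Complex.I * κ / l * x) - 2 * Real.pi * Complex.I * κ := by
      push_cast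
      field_simp
      ring
    simp only [φ]
    rw [e1, hper _ (mem_halfPlane hy), e2, Complex.exp_sub]
    have := Complex.exp_ne_zero (2 * Real.pi * Complex.I * κ)
    field_simp
  let Φ : C(AddCircle (l : ℝ), ℂ) := ⟨hφp.lift, continuous_coinduced_dom.mpr hφc⟩
  have hcoeff : ∀ m : ℤ, fourierCoeff Φ m
      = (l : ℂ)⁻¹ * fourierInt l (2 * Real.pi * (κ + m) / l) f y := by
    intro m
    rw [fourierCoeff_eq_intervalIntegral _ _ 0, zero_add, Complex.real_smul, one_div,
      Complex.ofReal_inv, Complex.ofReal_natCast, fourierInt]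
    congr 1
    refine intervalIntegral.integral_congr fun x _ => ?_
    have e : Φ (x : AddCircle (l : ℝ)) = φ x := hφp.lift_coe x
    rw [e, fourier_coe_apply, smul_eq_mul]
    simp only [φ]
    rw [mul_left_comm, ← Complex.exp_add]
    congr 2
    push_cast
    field_simp
    ring
  have hsum : Summable (fourierCoeff Φ) := by
    obtain ⟨C, hC⟩ := exists_sq_mul_norm_fourierInt_le hf hper hy
    have hS := ((Real.summable_one_div_int_add_rpow κ 2).mpr one_lt_two).mul_left
      ((l : ℝ)⁻¹ * (C * (l / (2 * Real.pi)) ^ 2))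
    refine Summable.of_norm_bounded_eventually hS ?_
    -- The bound by `α⁻²` is empty at frequency zero, which is at most one index and is excluded.
    have hfin : {m : ℤ | (m : ℝ) + κ = 0}.Finite := by
      refine Set.Subsingleton.finite fun m hm n hn => ?_
      simp only [Set.mem_ofPred_eq] at hm hn
      have : (m : ℝ) = n := by linarith
      exact_mod_cast this
    filter_upwards [hfin.compl_mem_cofinite] with m hm
    have hm0 : (m : ℝ) + κ ≠ 0 := hm
    have h := hC (2 * Real.pi * (κ + m) / l) (exp_mul_exp_frequency hl κ m)
    rw [hcoeff, norm_mul, norm_inv, Complex.norm_natCast]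
    refine (mul_le_mul_of_nonneg_left ?_ (by positivity)).trans_eq (mul_assoc _ _ _).symm
    rw [Real.rpow_two, sq_abs, mul_one_div, le_div_iff₀ (by positivity)]
    have hpi := Real.pi_pos
    calc _ = (2 * Real.pi * (κ + m) / l) ^ 2 * ‖fourierInt l (2 * Real.pi * (κ + m) / l) f y‖
          * (l / (2 * Real.pi)) ^ 2 := by
          field_simp
          ring
      _ ≤ C * (l / (2 * Real.pi)) ^ 2 := by gcongr
  have h := (has_pointwise_sum_fourier_series_of_summable hsum (x : AddCircle (l : ℝ))).mul_right
    (Complex.exp (2 * Real.pi * Complex.I * κ / l * x))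
  have e : Φ (x : AddCircle (l : ℝ)) = φ x := hφp.lift_coe x
  have e2 : φ x * Complex.exp (2 * Real.pi * Complex.I * κ / l * x) = f (x + y * Complex.I) := by
    simp only [φ]
    rw [mul_assoc, ← Complex.exp_add, neg_add_cancel, Complex.exp_zero, mul_one]
  rw [e, e2] at h
  refine h.congr_fun fun m => ?_
  rw [hcoeff, fourier_coe_apply, smul_eq_mul, mul_assoc _ (Complex.exp _) (Complex.exp _),
    ← Complex.exp_add]
  congr 2
  push_cast
  field_simp
  ring

/-! ### Identification of the Fourier coefficients -/

section Coefficients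

variable {k ν : ℂ} {l : ℕ} {n : ℝ} {a a' : ℝ → ℂ}

theorem scaled_pos (hl : 0 < l) (hn : n ≠ 0) : 0 < 4 * Real.pi * |n| / (l : ℝ) := by
  have hl' : (0 : ℝ) < l := by exact_mod_cast hl
  have := Real.pi_pos
  positivity

/-- With `α = 2πn/l` and `β = 4π|n|/l` one has `β² = 4α²` and `β sign(n) = 2α`. This is the reason
for the first parameter `sign(n) k/2`. -/
theorem fourier_coeff_eq_whittakerCoeff (hl : 0 < l) (hn : n ≠ 0) {y : ℝ} (hy : 0 < y) :
    ((4 * Real.pi * |n| / (l : ℝ) : ℝ) : ℂ) ^ 2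
        * whittakerCoeff ((Real.sign n : ℂ) * k / 2) ν (4 * Real.pi * |n| / (l : ℝ) * y)
      = ((2 * Real.pi * n / l : ℝ) : ℂ) ^ 2 - k * ((2 * Real.pi * n / l : ℝ) : ℂ) / y
        - (1 / 4 - ν ^ 2) / (y : ℂ) ^ 2 := by
  have hy0 : (y : ℂ) ≠ 0 := by exact_mod_cast hy.ne'
  have hβ : ((4 * Real.pi * |n| / (l : ℝ) : ℝ) : ℂ) ≠ 0 := by
    exact_mod_cast (scaled_pos hl hn).ne'
  have h1 : (4 * Real.pi * |n| / (l : ℝ)) ^ 2 = 4 * (2 * Real.pi * n / l) ^ 2 := by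
    rw [div_pow, mul_pow, sq_abs]
    ring
  have h2 : 4 * Real.pi * |n| / (l : ℝ) * Real.sign n = 2 * (2 * Real.pi * n / l) := by
    have : |n| * Real.sign n = n := by
      rcases hn.lt_or_gt with h | h
      · rw [abs_of_neg h, Real.sign_of_neg h, neg_mul_neg, mul_one]
      · rw [abs_of_pos h, Real.sign_of_pos h, mul_one]
    linear_combination (4 * Real.pi / l) * this
  generalize 4 * Real.pi * |n| / (l : ℝ) = β at *
  generalize 2 * Real.pi * n / (l : ℝ) = α at *
  have h1' : (β : ℂ) ^ 2 = 4 * (α : ℂ) ^ 2 := by exact_mod_cast h1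
  have h2' : (β : ℂ) * (Real.sign n : ℂ) = 2 * α := by exact_mod_cast h2
  rw [whittakerCoeff]
  push_cast
  field_simp
  linear_combination (2 * (y : ℂ) ^ 2) * h1' - 4 * k * y * h2'

theorem IsSol.comp_scaled (hl : 0 < l) (hn : n ≠ 0) {f f' : ℝ → ℂ}
    (hf : IsSol (whittakerCoeff ((Real.sign n : ℂ) * k / 2) ν) f f') :
    IsSol (fun y => ((2 * Real.pi * n / l : ℝ) : ℂ) ^ 2 - k * ((2 * Real.pi * n / l : ℝ) : ℂ) / y
        - (1 / 4 - ν ^ 2) / (y : ℂ) ^ 2)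
      (fun y => f (4 * Real.pi * |n| / (l : ℝ) * y))
      (fun y => ((4 * Real.pi * |n| / (l : ℝ) : ℝ) : ℂ) * f' (4 * Real.pi * |n| / (l : ℝ) * y)) :=
  (hf.comp_mul (scaled_pos hl hn)).congr_coeff
    fun _ hy => (fourier_coeff_eq_whittakerCoeff hl hn hy).symm

theorem continuousOn_fourier_coeff (k ev α : ℂ) :
    ContinuousOn (fun y : ℝ => α ^ 2 - k * α / y - ev / (y : ℂ) ^ 2) (Set.Ioi 0) := by
  intro y hy
  have hy0 : (y : ℂ) ≠ 0 := by exact_mod_cast (ne_of_gt hy : y ≠ 0)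
  have hy2 : (y : ℂ) ^ 2 ≠ 0 := pow_ne_zero 2 hy0
  refine ContinuousAt.continuousWithinAt ?_
  fun_prop (disch := assumption)

theorem fourier_coeff_isBigO (k ev α : ℂ) :
    (fun y : ℝ => α ^ 2 - k * α / y - ev / (y : ℂ) ^ 2) =O[atTop] fun _ => (1 : ℝ) := by
  have h1 := tendsto_ofReal_inv_atTop
  have h : Tendsto (fun y : ℝ => α ^ 2 - k * α / y - ev / (y : ℂ) ^ 2) atTop
      (𝓝 (α ^ 2 - k * α * 0 - ev * 0 ^ 2)) := by
    refine ((tendsto_const_nhds.sub (h1.const_mul (k * α))).sub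
      ((h1.pow 2).const_mul ev)).congr fun t => ?_
    simp only [div_eq_mul_inv, inv_pow]
  exact h.isBigO_one ℝ

/-- Solutions of small growth are multiples of `W`. -/
theorem eq_whittakerWt_of_isBigO (hl : 0 < l) (hn : n ≠ 0)
    (ha : IsSol (fun y => ((2 * Real.pi * n / l : ℝ) : ℂ) ^ 2
      - k * ((2 * Real.pi * n / l : ℝ) : ℂ) / y - (1 / 4 - ν ^ 2) / (y : ℂ) ^ 2) a a') {c : ℝ}
    (hc : c < 2 * Real.pi * |n| / (l : ℝ)) (haO : a =O[atTop] fun y => Real.exp (c * y)) :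
    ∃ A : ℂ, ∀ y : ℝ, 0 < y →
      a y = A * whittakerWt ((Real.sign n : ℂ) * k / 2) ν (4 * Real.pi * |n| / (l : ℝ) * y) := by
  obtain ⟨W', hW, hWd, t, ht, hne⟩ := isRecessive_whittakerW ((Real.sign n : ℂ) * k / 2) ν
  have hβ := scaled_pos hl hn
  set β := 4 * Real.pi * |n| / (l : ℝ) with hβdef
  have hcβ : c / β < 1 / 2 := by
    rw [div_lt_iff₀ hβ, hβdef]
    linear_combination hc
  -- `W(βy)` is `O(e^{-rβy})` for every `r < 1/2`; such an `r` is chosen with `c < rβ`, so that the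
  -- decay of `W` beats the growth of `a`.
  obtain ⟨r, hr1, hr2⟩ := exists_between hcβ
  rw [div_lt_iff₀ hβ] at hr1
  refine ha.exists_smul_of_isBigO (hW.comp_scaled hl hn) (continuousOn_fourier_coeff _ _ _)
    (fourier_coeff_isBigO _ _ _) hr1 haO ?_ (div_pos ht hβ) ?_
  · refine ((hWd.isBigO hr2).comp_tendsto (tendsto_id.const_mul_atTop hβ)).congr_right fun y => ?_
    simp only [Function.comp_apply, id]
    ring_nf
  · rwa [mul_div_cancel₀ _ hβ.ne']

/-- All solutions are combinations of `W` and `M̃`. -/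
theorem eq_whittakerWt_add_whittakerMt (hl : 0 < l) (hn : n ≠ 0)
    (ha : IsSol (fun y => ((2 * Real.pi * n / l : ℝ) : ℂ) ^ 2
      - k * ((2 * Real.pi * n / l : ℝ) : ℂ) / y - (1 / 4 - ν ^ 2) / (y : ℂ) ^ 2) a a')
    (hν : ∀ m : ℕ, 1 + 2 * ν + m ≠ 0)
    (hκ : ∀ m : ℕ, 1 / 2 + ν - (Real.sign n : ℂ) * k / 2 + m ≠ 0) :
    ∃ A B : ℂ, ∀ y : ℝ, 0 < y →
      a y = A * whittakerWt ((Real.sign n : ℂ) * k / 2) ν (4 * Real.pi * |n| / (l : ℝ) * y)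
        + B * whittakerMt ((Real.sign n : ℂ) * k / 2) ν (4 * Real.pi * |n| / (l : ℝ) * y) := by
  obtain ⟨W', M', hW, hM, hne⟩ := exists_fundamental_system hν hκ
  have hβ := scaled_pos hl hn
  have hβ0 : ((4 * Real.pi * |n| / (l : ℝ) : ℝ) : ℂ) ≠ 0 := by exact_mod_cast hβ.ne'
  -- The Wronskian is evaluated at `y = 1/β`, which corresponds to `t = 1`; the scaling contributes
  -- the non-zero factor `β`.
  refine ha.exists_combination (hW.comp_scaled hl hn) (hM.comp_scaled hl hn)
    (continuousOn_fourier_coeff _ _ _) (inv_pos.mpr hβ) ?_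
  simp only [mul_inv_cancel₀ hβ.ne']
  intro h0
  refine hne ((mul_eq_zero.mp ?_).resolve_left hβ0)
  linear_combination h0

/-- The coefficient of order zero is a combination of two powers of `y`. -/
theorem eq_cpow_add_cpow (hν : ν ≠ 0)
    (ha : IsSol (fun y => -(1 / 4 - ν ^ 2) / (y : ℂ) ^ 2) a a') :
    ∃ C₁ C₂ : ℂ, ∀ y : ℝ, 0 < y →
      a y = C₁ * (y : ℂ) ^ (1 / 2 + ν) + C₂ * (y : ℂ) ^ (1 / 2 - ν) := by
  have hpow : ∀ s : ℂ, s * (s - 1) = -(1 / 4 - ν ^ 2) →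
      IsSol (fun y => -(1 / 4 - ν ^ 2) / (y : ℂ) ^ 2) (fun y => (y : ℂ) ^ s)
        (fun y => s / y * (y : ℂ) ^ s) := by
    intro s hs y hy
    have hy0 : (y : ℂ) ≠ 0 := by exact_mod_cast hy.ne'
    refine ⟨hasDerivAt_ofReal_cpow hy s, ?_⟩
    refine (((hasDerivAt_inv hy0).comp_ofReal.const_mul s).mul
      (hasDerivAt_ofReal_cpow hy s)).congr_deriv ?_
    rw [← hs]
    field_simp
    ring
  have hQ : ContinuousOn (fun y : ℝ => -(1 / 4 - ν ^ 2) / (y : ℂ) ^ 2) (Set.Ioi 0) := by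
    refine (continuousOn_fourier_coeff 0 (1 / 4 - ν ^ 2) 0).congr fun y _ => ?_
    ring
  -- The Wronskian of the two powers at `1` is `-2ν`; this is where `ν ≠ 0` enters.
  refine ha.exists_combination (hpow (1 / 2 + ν) (by ring)) (hpow (1 / 2 - ν) (by ring)) hQ
    one_pos ?_
  simp only [Complex.ofReal_one, Complex.one_cpow, div_one, mul_one, one_mul]
  intro h0
  refine hν ?_
  linear_combination (-1 / 2 : ℂ) * h0

end Coefficients

/-! ### Regrouping the Fourier series by frequency -/

theorem frequencies_eq (κ : ℝ) :
    frequencies κ = Set.range (fun m : ℤ => κ + (m : ℝ)) \ {0} := by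
  ext n
  simp only [frequencies, Set.mem_ofPred_eq, Set.mem_sdiff, Set.mem_range, Set.mem_singleton_iff]
  refine and_congr_left fun _ => ⟨?_, ?_⟩
  · rintro ⟨m, rfl⟩
    exact ⟨m, rfl⟩
  · rintro ⟨m, rfl⟩
    exact ⟨m, rfl⟩

/-- Regrouping of a sum over `κ + ℤ`: the finitely many low frequencies and the frequency zero are
split off. -/
theorem hasSum_frequencies {κ : ℝ} {S : Set ℝ} (hS : S.Finite) (hSf : S ⊆ frequencies κ)
    {b w r : ℝ → ℂ} {s : ℂ} (hb : HasSum (fun m : ℤ => b (κ + m)) s)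
    (hw : ∀ n ∈ frequencies κ, b n = w n + r n) (hr : ∀ n ∈ frequencies κ, n ∉ S → r n = 0) :
    HasSum (fun n : frequencies κ => w n)
      (s - (Set.range (fun m : ℤ => κ + (m : ℝ))).indicator b 0 - ∑ᶠ (n : ℝ) (_ : n ∈ S), r n) := by
  set R := Set.range (fun m : ℤ => κ + (m : ℝ)) with hR
  have hinj : Function.Injective (fun m : ℤ => κ + (m : ℝ)) := fun m m' h => by
    have : (m : ℝ) = m' := by simpa using h
    exact_mod_cast this
  -- All sums are extended by zero to unconditional sums over `ℝ`, where they can be subtracted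
  -- pointwise.
  have h1 : HasSum (R.indicator b) s :=
    hasSum_subtype_iff_indicator.mp (hinj.hasSum_range_iff.mpr hb)
  have h2 : HasSum (fun n : ℝ => if n = 0 then R.indicator b 0 else 0) (R.indicator b 0) :=
    hasSum_ite_eq 0 _
  have h3 : HasSum (S.indicator r) (∑ᶠ (n : ℝ) (_ : n ∈ S), r n) := by
    rw [finsum_mem_eq_finite_toFinset_sum _ hS]
    have : HasSum (S.indicator r) (∑ n ∈ hS.toFinset, S.indicator r n) :=
      hasSum_sum_of_ne_finset_zero fun n hn => by
        rw [Set.indicator_of_notMem]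
        simpa using hn
    convert! this using 1
    refine Finset.sum_congr rfl fun n hn => ?_
    rw [Set.indicator_of_mem]
    simpa using hn
  refine (hasSum_subtype_iff_indicator (f := w)).mpr (((h1.sub h2).sub h3).congr_fun fun n => ?_)
  by_cases hn : n ∈ frequencies κ
  · have hn' := hn
    rw [frequencies_eq] at hn'
    have hn0 : n ≠ 0 := by simpa using hn'.2
    rw [Set.indicator_of_mem hn, Set.indicator_of_mem hn'.1, if_neg hn0, hw n hn]
    by_cases hnS : n ∈ S
    · rw [Set.indicator_of_mem hnS]
      ring
    · rw [Set.indicator_of_notMem hnS, hr n hn hnS]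
      ring
  · rw [Set.indicator_of_notMem hn, Set.indicator_of_notMem fun h => hn (hSf h)]
    by_cases hn0 : n = 0
    · rw [if_pos hn0, hn0]
      ring
    · have : n ∉ R := fun h => hn (by
        rw [frequencies_eq]
        exact ⟨h, hn0⟩)
      rw [if_neg hn0, Set.indicator_of_notMem this]
      ring

end GenMaass
end

/-! ### The Whittaker-Fourier expansion at a cusp -/

theorem proposition4p1
    (Γ : Subgroup SL(2, ℤ)) [Γ.FiniteIndex] (k ν : ℂ) (v : Γ → ℂˣ)
    (hv : GenMaass.IsMultiplier Γ k v) (hpar : GenMaass.IsWeaklyParabolic Γ v)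
    (hν : ∀ m : ℕ, 1 ≤ m → ν ≠ -((m : ℂ) / 2))
    (u : ℍ → ℂ) (hu : GenMaass.IsGeneralizedMaassForm Γ k v (1 / 4 - ν ^ 2) u)
    -- the cusp `q = g ∞`, its scaling matrix, width and parabolic generator
    (g : SL(2, ℤ)) (l : ℕ) (γq : Γ) (hq : GenMaass.IsCuspGenerator Γ g l γq)
    (κ : ℝ) (hκ : (v γq : ℂ) = Complex.exp (2 * Real.pi * Complex.I * κ))
    -- `y^{1/2+ν}` and `y^{1/2-ν}` are independent if they can occur
    (hν0 : ν = 0 → (v γq : ℂ) ≠ 1)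
    (c M : ℝ) (hc : GenMaass.HasExpGrowthAt g u c) (hcM : c < M)
    -- the functions `M̃_{sign(n) k/2, ν}` occurring in the expansion are defined
    (hk : ∀ n ∈ GenMaass.lowFrequencies κ l M, ∀ m : ℕ,
      (Real.sign n : ℂ) * k / 2 - ν ≠ 1 / 2 + (m : ℂ)) :
    ∃ (A B : ℝ → ℂ) (Cplus Cminus : ℂ),
      ((v γq : ℂ) ≠ 1 → Cplus = 0 ∧ Cminus = 0) ∧
      ∀ z : ℍ,
        Summable (fun n : GenMaass.frequencies κ => A n * GenMaass.wTerm k ν l n z) ∧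
        GenMaass.slash k g u z =
          (∑' n : GenMaass.frequencies κ, A n * GenMaass.wTerm k ν l n z)
          + (∑ᶠ (n : ℝ) (_ : n ∈ GenMaass.lowFrequencies κ l M),
              B n * GenMaass.mTerm k ν l n z)
          + Cplus * (z.im : ℂ) ^ (1 / 2 + ν) + Cminus * (z.im : ℂ) ^ (1 / 2 - ν) := by
  open GenMaass in
  have hl := hq.pos
  have hl' : (0 : ℝ) < l := by exact_mod_cast hl
  obtain ⟨_, _, _, _, _, _, hU, heU⟩ := hu.exists_hasHessian
  obtain ⟨f₁, f₂, f₁₁, f₁₂, f₂₁, f₂₂, hf, he⟩ := slashC_isEigen g hU heU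
  have hper : ∀ w ∈ halfPlane, slashC k g (fun w => u (ofComplex w)) (w + l)
      = Complex.exp (2 * Real.pi * Complex.I * κ) * slashC k g (fun w => u (ofComplex w)) w := by
    intro w hw
    rw [← hκ]
    exact slashC_add hu.slash_eq hl hq.mul_eq hw
  -- The strip `|x| ≤ l` contains the period `[0, l]` over which the coefficients are integrated.
  obtain ⟨C, Y, hY, hC0, hgrow⟩ := hc.slashC (k := k) (l : ℝ)
  set f := slashC k g (fun w => u (ofComplex w)) with hfdef
  have hsol : ∀ m : ℤ, IsSol _ (fourierInt l (2 * Real.pi * (κ + m) / l) f) _ :=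
    fun m => isSol_fourierInt hf he hper (exp_mul_exp_frequency hl κ m)
  have hbig : ∀ α : ℝ, fourierInt l α f =O[atTop] fun y => Real.exp (c * y) := by
    intro α
    refine IsBigO.of_bound (C * l) ?_
    filter_upwards [eventually_ge_atTop Y] with y hy
    rw [Real.norm_of_nonneg (Real.exp_pos _).le]
    refine (norm_fourierInt_le α fun x hx0 hx1 => hgrow x y ?_ hy).trans_eq (by ring)
    rwa [abs_of_nonneg hx0]
  -- `1 + 2ν = -m` means `ν = -(m+1)/2`, whence the index `m + 1`. The excluded `ν` are those for
  -- which the Kummer series in `M` has a zero denominator.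
  have hνb : ∀ m : ℕ, 1 + 2 * ν + m ≠ 0 := by
    intro m h
    refine hν (m + 1) (Nat.le_add_left 1 m) ?_
    push_cast
    linear_combination h / 2
  have hcoeff : ∀ n ∈ frequencies κ, ∃ A B : ℂ, (n ∉ lowFrequencies κ l M → B = 0) ∧
      ∀ y : ℝ, 0 < y → (l : ℂ)⁻¹ * fourierInt l (2 * Real.pi * n / l) f y
        = A * (((|n| ^ (-(1 / 2) : ℝ) : ℝ) : ℂ)
            * whittakerWt ((Real.sign n : ℂ) * k / 2) ν (4 * Real.pi * |n| / (l : ℝ) * y))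
          + B * (((|n| ^ (-(1 / 2) : ℝ) : ℝ) : ℂ)
            * whittakerMt ((Real.sign n : ℂ) * k / 2) ν (4 * Real.pi * |n| / (l : ℝ) * y)) := by
    rintro n hn
    obtain ⟨⟨m, rfl⟩, hn0⟩ := id hn
    have hp : (((|κ + (m : ℝ)| ^ (-(1 / 2) : ℝ) : ℝ) : ℂ)) ≠ 0 := by
      have := Real.rpow_pos_of_pos (abs_pos.mpr hn0) (-(1 / 2))
      exact_mod_cast this.ne'
    -- At low frequencies `hk` keeps `Γ(1/2 + ν - sign(n) k/2)` away from its poles, so `W` and `M̃`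
    -- form a basis. At the others `2π|n|/l ≥ M > c`, and growth rules out `M̃`. The factor
    -- `|n|^{-1/2}` is absorbed into the constants, as `n ≠ 0`.
    by_cases hlow : κ + (m : ℝ) ∈ lowFrequencies κ l M
    · obtain ⟨A, B, hAB⟩ := eq_whittakerWt_add_whittakerMt hl hn0 (hsol m) hνb fun j hj =>
        hk _ hlow j (by linear_combination -hj)
      refine ⟨(l : ℂ)⁻¹ * A / ((|κ + (m : ℝ)| ^ (-(1 / 2) : ℝ) : ℝ) : ℂ),
        (l : ℂ)⁻¹ * B / ((|κ + (m : ℝ)| ^ (-(1 / 2) : ℝ) : ℝ) : ℂ), fun h => absurd hlow h,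
        fun y hy => ?_⟩
      rw [hAB y hy]
      generalize (((|κ + (m : ℝ)| ^ (-(1 / 2) : ℝ) : ℝ) : ℂ)) = p at *
      field_simp
    · have hcn : c < 2 * Real.pi * |κ + (m : ℝ)| / (l : ℝ) :=
        hcM.trans_le (not_lt.mp fun h => hlow ⟨hn, h⟩)
      obtain ⟨A, hA⟩ := eq_whittakerWt_of_isBigO hl hn0 (hsol m) hcn (hbig _)
      refine ⟨(l : ℂ)⁻¹ * A / ((|κ + (m : ℝ)| ^ (-(1 / 2) : ℝ) : ℝ) : ℂ), 0, fun _ => rfl,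
        fun y hy => ?_⟩
      rw [hA y hy]
      generalize (((|κ + (m : ℝ)| ^ (-(1 / 2) : ℝ) : ℝ) : ℂ)) = p at *
      field_simp
      ring
  choose! A B hB hAB using hcoeff
  let b : ℍ → ℝ → ℂ := fun z n => (l : ℂ)⁻¹ * fourierInt l (2 * Real.pi * n / l) f z.im
    * Complex.exp (2 * Real.pi * Complex.I * n / (l : ℂ) * z.re)
  have hzero : ∃ Cplus Cminus : ℂ, ((v γq : ℂ) ≠ 1 → Cplus = 0 ∧ Cminus = 0) ∧ ∀ z : ℍ,
      (Set.range (fun m : ℤ => κ + (m : ℝ))).indicator (b z) 0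
        = Cplus * (z.im : ℂ) ^ (1 / 2 + ν) + Cminus * (z.im : ℂ) ^ (1 / 2 - ν) := by
    -- Frequency zero occurs only if `κ` is an integer, which makes `v(γ_q) = 1`; then `hν0` gives
    -- `ν ≠ 0`. Otherwise both constants are zero.
    by_cases h0 : (0 : ℝ) ∈ Set.range (fun m : ℤ => κ + (m : ℝ))
    · obtain ⟨m, hm⟩ := id h0
      have hm' : κ + (m : ℝ) = 0 := hm
      have hv1 : (v γq : ℂ) = 1 := by
        rw [hκ, Complex.exp_eq_one_iff]
        refine ⟨-m, ?_⟩
        have : (κ : ℂ) = -(m : ℂ) := by exact_mod_cast eq_neg_of_add_eq_zero_left hm'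
        rw [this]
        push_cast
        ring
      have hs := hsol m
      rw [hm', mul_zero, zero_div] at hs
      obtain ⟨C₁, C₂, h⟩ := eq_cpow_add_cpow (ν := ν) (fun h => hν0 h hv1)
        (hs.congr_coeff fun y _ => by
          simp only [Complex.ofReal_zero]
          ring)
      refine ⟨(l : ℂ)⁻¹ * C₁, (l : ℂ)⁻¹ * C₂, fun h => absurd hv1 h, fun z => ?_⟩
      rw [Set.indicator_of_mem h0]
      simp only [b]
      rw [mul_zero, zero_div, h _ z.im_pos]
      simp
      ring
    · refine ⟨0, 0, fun _ => ⟨rfl, rfl⟩, fun z => ?_⟩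
      rw [Set.indicator_of_notMem h0]
      ring
  obtain ⟨Cplus, Cminus, hCv, hC⟩ := hzero
  refine ⟨A, B, Cplus, Cminus, hCv, fun z => ?_⟩
  have hF : HasSum (fun m : ℤ => b z (κ + m)) (slash k g u z) := by
    have := hasSum_fourierInt hl hf hper z.im_pos z.re
    have hz : ((z.re : ℂ) + z.im * Complex.I) = (z : ℂ) := Complex.re_add_im (z : ℂ)
    rwa [hz, hfdef, ← slash_eq_slashC] at this
  have key := hasSum_frequencies (lowFrequencies_finite κ l hl M) (fun n hn => hn.1) hF
    (w := fun n => A n * wTerm k ν l n z) (r := fun n => B n * mTerm k ν l n z)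
    (fun n hn => by
      simp only [b, wTerm, mTerm]
      rw [hAB n hn z.im z.im_pos]
      ring)
    (fun n hn hS => by rw [hB n hn hS, zero_mul])
  refine ⟨key.summable, ?_⟩
  rw [key.tsum_eq, hC z]
  ring
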